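/- Let $f$ be a holomorphic function in a neighbourhood of $0\in\mathbb{C}^3$ with Taylor expansion $\sum_{\nu\in\mathbb{N}^3}a_\nu z^\nu$ at $0$, and suppose that $f$ is an isolated singularity: $f\not\equiv 0$ near $0$, $f(0)=0$, $\nabla f(0)=0$, and $\nabla f(z)\neq 0$ for all $z\neq 0$ close to $0$. Let $\Gamma_+(f)=\operatorname{conv}\bigcup_{a_\nu\ne 0}(\nu+\mathbb{R}_{\ge 0}^3)\subset\mathbb{R}^3$ be its Newton diagram. A face of $\Gamma_+(f)$ is a set of the form $\{v\in\Gamma_+(f):\langle u,v\rangle=\inf_{w\in\Gamma_+(f)}\langle u,w\rangle\}$ with $u\in\mathbb{R}_{\ge 0}^3\setminus\{0\}$, and $\Gamma^2(f)$ denotes the set of compact $2$-dimensional faces. A face $S\in\Gamma^2(f)$ is called exceptional with respect to the coordinate axis $OX_i$ if one of its vertices is at (Euclidean) distance $1$ from $OX_i$ and its other vertices constitute a $1$-dimensional face (an edge of $S$) lying in one of the coordinate planes containing $OX_i$. Let $E_f$ be the set of those $S\in\Gamma^2(f)$ that are exceptional with respect to some axis $OX_i$, $i\in\{1,2,3\}$;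 the elements of $\Gamma^2(f)\setminus E_f$ are called unexceptional. Assume that $\Gamma^2(f)\setminus E_f\neq\emptyset$. Then for every $i\in\{1,2,3\}$ there exists a face $S_i\in\Gamma^2(f)\setminus E_f$ for which at least one of the following two conditions holds: (i) there exists a point $W\in OX_i$ which is a vertex of $S_i$; (ii) there exist $j,k\in\{1,2,3\}\setminus\{i\}$, $j\neq k$, and vertices $W\in OX_iX_j$, at distance $1$ from the axis $OX_i$, and $Y\in OX_iX_k$ of $S_i$ such that the segment $\overline{WY}$ is an edge of $S_i$. -/

import Mathlib

open Set Topology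

noncomputable section

namespace NewtonDiagram

/-- The partial derivative `∂f/∂z_i`, as a function on `ℂⁿ`. -/
def partialDeriv {n : ℕ} (i : Fin n) (f : (Fin n → ℂ) → ℂ) : (Fin n → ℂ) → ℂ :=
  fun z => fderiv ℂ f z (Pi.single i 1)

/-- The mixed partial derivative `∂^{|ν|} f / ∂z_1^{ν_1} ⋯ ∂z_n^{ν_n}`. -/
def mixedPartialDeriv {n : ℕ} (ν : Fin n → ℕ) (f : (Fin n → ℂ) → ℂ) : (Fin n → ℂ) → ℂ :=
  (List.finRange n).foldr (fun i g => (partialDeriv i)^[ν i] g) f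

/-- The coefficient `a_ν` of the Taylor expansion `∑ a_ν z^ν` of `f` at the origin. -/
def taylorCoeff {n : ℕ} (f : (Fin n → ℂ) → ℂ) (ν : Fin n → ℕ) : ℂ :=
  mixedPartialDeriv ν f 0 / ((∏ i, (ν i).factorial : ℕ) : ℂ)

/-- `f` is a singularity: a nonzero germ at `0` of a holomorphic function
with `f(0) = 0` and `∇f(0) = 0`. -/
structure IsSingularity {n : ℕ} (f : (Fin n → ℂ) → ℂ) : Prop where
  analyticAt : AnalyticAt ℂ f 0
  nonzero : ¬ (∀ᶠ z in 𝓝 (0 : Fin n → ℂ), f z = 0)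
  map_zero : f 0 = 0
  gradient_zero : ∀ i, partialDeriv i f 0 = 0

/-- `f` is an isolated singularity: moreover `∇f(z) ≠ 0` for all `z ≠ 0` close to `0`. -/
structure IsIsolatedSingularity {n : ℕ} (f : (Fin n → ℂ) → ℂ) : Prop extends
    IsSingularity f where
  isolated : ∀ᶠ z in 𝓝[≠] (0 : Fin n → ℂ), ∃ i, partialDeriv i f z ≠ 0

/-- The Newton diagram `Γ₊(f) = conv {ν + ℝ₊ⁿ : a_ν ≠ 0}`. -/
def newtonDiagram {n : ℕ} (f : (Fin n → ℂ) → ℂ) : Set (EuclideanSpace ℝ (Fin n)) :=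
  convexHull ℝ {x | ∃ ν : Fin n → ℕ, taylorCoeff f ν ≠ 0 ∧ ∀ i, (ν i : ℝ) ≤ x i}

/-- `Δ(u, A)`: the set of points of `A` at which `⟨u, ·⟩` attains its infimum over `A`. -/
def supportSet {n : ℕ} (u : EuclideanSpace ℝ (Fin n)) (A : Set (EuclideanSpace ℝ (Fin n))) :
    Set (EuclideanSpace ℝ (Fin n)) :=
  {v | v ∈ A ∧ ∀ w ∈ A, inner ℝ u v ≤ inner ℝ u w}

/-- The Newton boundary `Γ(f)`: the family of all compact faces `Δ(u, Γ₊(f))`,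
`u ∈ ℝ₊ⁿ \ {0}`, of the Newton diagram. -/
def newtonBoundary {n : ℕ} (f : (Fin n → ℂ) → ℂ) : Set (Set (EuclideanSpace ℝ (Fin n))) :=
  {S | (∃ u : EuclideanSpace ℝ (Fin n), (∀ i, 0 ≤ u i) ∧ u ≠ 0 ∧
      S = supportSet u (newtonDiagram f)) ∧ IsCompact S}

/-- The (affine) dimension of a convex set. -/
def dim {n : ℕ} (S : Set (EuclideanSpace ℝ (Fin n))) : ℕ :=
  Module.finrank ℝ (vectorSpan ℝ S)

/-- `Γᵏ(f)`: the compact faces of dimension `k`. -/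
def newtonFaces {n : ℕ} (f : (Fin n → ℂ) → ℂ) (k : ℕ) :
    Set (Set (EuclideanSpace ℝ (Fin n))) :=
  {S | S ∈ newtonBoundary f ∧ dim S = k}

/-- The vertices of a (compact, convex) face. -/
def vertices {n : ℕ} (S : Set (EuclideanSpace ℝ (Fin n))) : Set (EuclideanSpace ℝ (Fin n)) :=
  S.extremePoints ℝ

/-- The segment joining `W` and `Y` is an edge (a one-dimensional face) of `S`. -/
def IsEdge {n : ℕ} (S : Set (EuclideanSpace ℝ (Fin n))) (W Y : EuclideanSpace ℝ (Fin n)) : Prop :=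
  W ≠ Y ∧ IsExposed ℝ S (segment ℝ W Y)

/-- The coordinate axis `OX_i`. -/
def axis {n : ℕ} (i : Fin n) : Set (EuclideanSpace ℝ (Fin n)) :=
  {x | ∀ l, l ≠ i → x l = 0}

/-- The coordinate plane `OX_iX_j`. -/
def coordPlane {n : ℕ} (i j : Fin n) : Set (EuclideanSpace ℝ (Fin n)) :=
  {x | ∀ l, l ≠ i → l ≠ j → x l = 0}

/-- The coordinate hyperplane `{x_j = 0}`. It contains the axis `OX_i` iff `j ≠ i`. -/
def coordHyperplane {n : ℕ} (j : Fin n) : Set (EuclideanSpace ℝ (Fin n)) :=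
  {x | x j = 0}

/-- `S` (a compact face of dimension `n - 1`) is exceptional with respect to the axis `OX_i`:
one of its vertices is at (Euclidean) distance `1` to `OX_i`, and the other vertices
constitute an `(n-2)`-dimensional face of `S` which lies in a coordinate hyperplane
including `OX_i`. -/
def IsExceptionalWrt {n : ℕ} (S : Set (EuclideanSpace ℝ (Fin n))) (i : Fin n) : Prop :=
  ∃ W ∈ vertices S, Metric.infDist W (axis i) = 1 ∧
    IsExposed ℝ S (convexHull ℝ (vertices S \ {W})) ∧
    dim (convexHull ℝ (vertices S \ {W})) + 2 = n ∧
    ∃ j, axis i ⊆ coordHyperplane j ∧ convexHull ℝ (vertices S \ {W}) ⊆ coordHyperplane j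

/-- `E_f`: the set of exceptional faces of `f`. -/
def exceptionalFaces {n : ℕ} (f : (Fin n → ℂ) → ℂ) : Set (Set (EuclideanSpace ℝ (Fin n))) :=
  {S | S ∈ newtonFaces f (n - 1) ∧ ∃ i, IsExceptionalWrt S i}

end NewtonDiagram

end

/-!
A face of the Newton diagram is encoded by a positive weight `u`, through the exponents `ν` of `f`
that minimise `⟨u, ν⟩`. Of the isolated singularity only three properties of its support are used.
All exponents have order at least two. Near every axis there is an exponent at distance at most
one, since otherwise `∇f` would vanish along the axis. Every coordinate plane `x_i = 0` contains an
exponent, since otherwise `f` and its tangential derivatives would vanish on `z_i = 0`, where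
`∂f/∂z_i` has no isolated zero.

An edge from `e_j + e_k` to a point of `OX_i` along which `x_j = x_k` makes every facet
exceptional, so an unexceptional facet excludes all such edges. Now fix an axis `OX_i` and call an
edge that joins the two coordinate planes through `OX_i`, with an end at distance one from `OX_i`,
a bridge. If there is a bridge `PQ`, choose one with `P_k + Q_j` maximal and turn the supporting
plane about it, away from `OX_i`, as far as possible: the resulting facet is unexceptional, as its
apex would produce a larger bridge or one of the excluded edges. If the support misses `OX_i`,
there is a bridge. If it meets `OX_i`, let `W` be its lowest point there. Some facet contains `W`;
if it is exceptional, then turning it about the edge from `W` to its apex yields an unexceptional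
facet through `W`, or else there is a bridge.
-/

noncomputable section

namespace NewtonDiagram

section Weight

variable {n : ℕ} {A : Set (Fin n → ℕ)} {u w : Fin n → ℝ} {μ ν P : Fin n → ℕ}

/-- The pairing `⟨u, ν⟩` of a real weight vector with a lattice point. -/
def weight (u : Fin n → ℝ) (ν : Fin n → ℕ) : ℝ := ∑ l, u l * ν l

/-- The points of `A` of minimal weight: the lattice points of `A` on the face of its Newton
polyhedron that is selected by `u`. -/
def minSet (A : Set (Fin n → ℕ)) (u : Fin n → ℝ) : Set (Fin n → ℕ) :=
  {ν | ν ∈ A ∧ ∀ μ ∈ A, weight u ν ≤ weight u μ}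

theorem weight_add_smul (u w : Fin n → ℝ) (t : ℝ) (ν : Fin n → ℕ) :
    weight (u + t • w) ν = weight u ν + t * weight w ν := by
  simp only [weight, Finset.mul_sum, ← Finset.sum_add_distrib, Pi.add_apply, Pi.smul_apply,
    smul_eq_mul, add_mul, mul_assoc]

theorem weight_mono (hu : ∀ l, 0 ≤ u l) (h : μ ≤ ν) : weight u μ ≤ weight u ν :=
  Finset.sum_le_sum fun l _ => mul_le_mul_of_nonneg_left (by exact_mod_cast h l) (hu l)

theorem weight_strictMono (hu : ∀ l, 0 < u l) (h : μ < ν) : weight u μ < weight u ν := by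
  obtain ⟨hle, l, hl⟩ := Pi.lt_def.mp h
  exact Finset.sum_lt_sum
    (fun l _ => mul_le_mul_of_nonneg_left (by exact_mod_cast hle l) (hu l).le)
    ⟨l, Finset.mem_univ l, mul_lt_mul_of_pos_left (by exact_mod_cast hl) (hu l)⟩

theorem weight_eq_of_mem_minSet (hμ : μ ∈ minSet A u) (hν : ν ∈ minSet A u) :
    weight u μ = weight u ν :=
  le_antisymm (hμ.2 ν hν.1) (hν.2 μ hμ.1)

theorem mem_minSet_of_weight_le (hμ : μ ∈ minSet A u) (hν : ν ∈ A)
    (h : weight u ν ≤ weight u μ) : ν ∈ minSet A u :=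
  ⟨hν, fun ρ hρ => h.trans (hμ.2 ρ hρ)⟩

theorem finite_minimal (A : Set (Fin n → ℕ)) : {ν | Minimal (· ∈ A) ν}.Finite :=
  WellQuasiOrderedLE.finite_of_isAntichain (setOfPred_minimal_antichain _)

theorem exists_minimal_le (hν : ν ∈ A) : ∃ μ, Minimal (· ∈ A) μ ∧ μ ≤ ν := by
  obtain ⟨μ, hμν, hμ⟩ := exists_minimal_le_of_wellFoundedLT (· ∈ A) ν hν
  exact ⟨μ, hμ, hμν⟩

theorem minimal_of_mem_minSet (hu : ∀ l, 0 < u l) (hν : ν ∈ minSet A u) : Minimal (· ∈ A) ν :=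
  minimal_iff_forall_lt.mpr ⟨hν.1, fun _ hlt hμ => (weight_strictMono hu hlt).not_ge (hν.2 _ hμ)⟩

theorem minSet_finite (hu : ∀ l, 0 < u l) : (minSet A u).Finite :=
  (finite_minimal A).subset fun _ => minimal_of_mem_minSet hu

theorem mem_minSet_of_forall_minimal (hu : ∀ l, 0 ≤ u l) (hP : P ∈ A)
    (h : ∀ μ, Minimal (· ∈ A) μ → weight u P ≤ weight u μ) : P ∈ minSet A u := by
  refine ⟨hP, fun σ hσ => ?_⟩
  obtain ⟨τ, hτ, hle⟩ := exists_minimal_le hσ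
  exact (h τ hτ).trans (weight_mono hu hle)

theorem minSet_nonempty (hu : ∀ l, 0 ≤ u l) (hA : A.Nonempty) : (minSet A u).Nonempty := by
  obtain ⟨ν, hν⟩ := hA
  obtain ⟨μ, hμ, -⟩ := exists_minimal_le hν
  obtain ⟨ρ, hρ, hmin⟩ := Set.exists_min_image _ (weight u) (finite_minimal A) ⟨μ, hμ⟩
  exact ⟨ρ, mem_minSet_of_forall_minimal hu hρ.1 hmin⟩

theorem minSet_nonempty_of_finite (hA : A.Finite) (hne : A.Nonempty) :
    (minSet A u).Nonempty :=
  Set.exists_min_image A (weight u) hA hne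

theorem mem_minSet_add_smul_of_weight_eq {t : ℝ} (hP : P ∈ minSet A u) (hν : ν ∈ minSet A u)
    (hw : weight w ν = weight w P) (hPt : P ∈ minSet A (u + t • w)) :
    ν ∈ minSet A (u + t • w) :=
  mem_minSet_of_weight_le hPt hν.1 <| by
    rw [weight_add_smul, weight_add_smul, hw, weight_eq_of_mem_minSet hP hν]

theorem weight_lt_of_mem_minSet_add_smul {t : ℝ} (ht : 0 ≤ t) (hP : P ∈ minSet A u)
    (hPt : P ∈ minSet A (u + t • w)) (hν : ν ∈ minSet A (u + t • w)) (hνu : ν ∉ minSet A u) :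
    weight w ν < weight w P := by
  have hlt : weight u P < weight u ν :=
    not_le.mp fun hle => hνu (mem_minSet_of_weight_le hP hν.1 hle)
  have heq := weight_eq_of_mem_minSet hPt hν
  rw [weight_add_smul, weight_add_smul] at heq
  exact lt_of_mul_lt_mul_left (by linarith) ht

theorem add_smul_pos_of_lt {t T : ℝ} (hu : ∀ l, 0 < u l) (hT : ∀ l, 0 ≤ (u + T • w) l)
    (ht : 0 ≤ t) (htT : t < T) (l : Fin n) : 0 < (u + t • w) l := by
  have hTl := hT l
  simp only [Pi.add_apply, Pi.smul_apply, smul_eq_mul] at hTl ⊢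
  rcases le_total 0 (w l) with h | _
  · linarith [hu l, mul_nonneg ht h]
  · by_contra! hle
    nlinarith [hu l]

theorem weight_add_smul_le_iff {t : ℝ} (h : weight w ν < weight w P) :
    weight (u + t • w) P ≤ weight (u + t • w) ν ↔
      t ≤ (weight u ν - weight u P) / (weight w P - weight w ν) := by
  rw [weight_add_smul, weight_add_smul, le_div_iff₀ (sub_pos.mpr h)]
  exact ⟨fun _ => by linarith, fun _ => by linarith⟩

theorem mem_minSet_add_smul_or_exists_weight_lt {T : ℝ} (hu : ∀ l, 0 < u l) (hT : 0 < T)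
    (huT : ∀ l, 0 ≤ (u + T • w) l) (hP : P ∈ minSet A u) :
    P ∈ minSet A (u + T • w) ∨ ∃ t : ℝ, 0 ≤ t ∧ (∀ l, 0 < (u + t • w) l) ∧
      P ∈ minSet A (u + t • w) ∧ ∃ ν ∈ minSet A (u + t • w), weight w ν < weight w P := by
  set N := {ν | Minimal (· ∈ A) ν ∧ weight (u + T • w) ν < weight (u + T • w) P}
  rcases N.eq_empty_or_nonempty with hN | hN
  · exact .inl <| mem_minSet_of_forall_minimal huT hP.1 fun μ hμ =>
      not_lt.mp fun hlt => eq_empty_iff_forall_notMem.mp hN μ ⟨hμ, hlt⟩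
  right
  have hdrop : ∀ ν ∈ N, weight w ν < weight w P := fun ν ⟨hν, hlt⟩ => by
    rw [weight_add_smul, weight_add_smul] at hlt
    exact lt_of_mul_lt_mul_left (by linarith [hP.2 ν hν.1]) hT.le
  -- the time at which `ν` overtakes `P`
  let hit : (Fin n → ℕ) → ℝ := fun ν => (weight u ν - weight u P) / (weight w P - weight w ν)
  obtain ⟨ν, hν, hmin⟩ :=
    Set.exists_min_image N hit ((finite_minimal A).subset fun _ h => h.1) hN
  have hd : 0 < weight w P - weight w ν := sub_pos.mpr (hdrop ν hν)
  have h0 : 0 ≤ hit ν := div_nonneg (sub_nonneg.mpr (hP.2 ν hν.1.1)) hd.le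
  have hlt : hit ν < T :=
    not_le.mp fun h => hν.2.not_ge ((weight_add_smul_le_iff (hdrop ν hν)).mpr h)
  have hpos := add_smul_pos_of_lt hu huT h0 hlt
  have hPm : P ∈ minSet A (u + hit ν • w) := by
    refine mem_minSet_of_forall_minimal (fun l => (hpos l).le) hP.1 fun μ hμ => ?_
    by_cases hμN : μ ∈ N
    · exact (weight_add_smul_le_iff (hdrop μ hμN)).mpr (hmin μ hμN)
    · have hPμ := hP.2 μ hμ.1
      have : weight (u + T • w) P ≤ weight (u + T • w) μ := not_lt.mp fun h => hμN ⟨hμ, h⟩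
      rw [weight_add_smul, weight_add_smul] at this ⊢
      nlinarith
  refine ⟨hit ν, h0, hpos, hPm, ν, mem_minSet_of_weight_le hPm hν.1.1 ?_, hdrop ν hν⟩
  rw [weight_add_smul, weight_add_smul]
  have : hit ν * (weight w P - weight w ν) = weight u ν - weight u P := div_mul_cancel₀ _ hd.ne'
  linarith

theorem eventually_nhdsGT_zero_add_mul_pos {a : ℝ} (ha : 0 < a) (b : ℝ) :
    ∀ᶠ t : ℝ in 𝓝[>] 0, 0 < a + t * b := by
  have hcont : Continuous fun t : ℝ => a + t * b := by fun_prop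
  exact nhdsWithin_le_nhds ((hcont.tendsto 0).eventually (lt_mem_nhds (by simpa using ha)))

theorem eventually_mem_minSet_or_weight_lt (hP : P ∈ minSet A u) (w : Fin n → ℝ) :
    ∀ᶠ t : ℝ in 𝓝[>] 0, ∀ μ ∈ {μ | Minimal (· ∈ A) μ},
      μ ∈ minSet A u ∨ weight (u + t • w) P < weight (u + t • w) μ := by
  rw [Filter.eventually_all_finite (finite_minimal A)]
  intro μ hμ
  by_cases hm : μ ∈ minSet A u
  · exact .of_forall fun _ => .inl hm
  have hlt : weight u P < weight u μ := not_le.mp fun h => hm (mem_minSet_of_weight_le hP hμ.1 h)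
  filter_upwards [eventually_nhdsGT_zero_add_mul_pos (sub_pos.mpr hlt)
    (weight w μ - weight w P)] with t ht
  rw [weight_add_smul, weight_add_smul]
  exact .inr (by linarith)

theorem exists_minSet_add_smul_eq (hu : ∀ l, 0 < u l) (w : Fin n → ℝ) :
    ∃ t : ℝ, (∀ l, 0 < (u + t • w) l) ∧ minSet A (u + t • w) = minSet (minSet A u) w := by
  rcases A.eq_empty_or_nonempty with rfl | hA
  · exact ⟨0, by simpa using hu, by simp [minSet]⟩
  obtain ⟨P, hP⟩ := minSet_nonempty_of_finite (u := w) (minSet_finite (A := A) hu)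
    (minSet_nonempty (fun l => (hu l).le) hA)
  have hpos : ∀ᶠ t : ℝ in 𝓝[>] 0, ∀ l, 0 < (u + t • w) l :=
    Filter.eventually_all.mpr fun l => eventually_nhdsGT_zero_add_mul_pos (hu l) (w l)
  obtain ⟨t, ⟨hpos, hsep⟩, ht : 0 < t⟩ :=
    ((hpos.and (eventually_mem_minSet_or_weight_lt hP.1 w)).and self_mem_nhdsWithin).exists
  have hPm : P ∈ minSet A (u + t • w) := by
    refine mem_minSet_of_forall_minimal (fun l => (hpos l).le) hP.1.1 fun μ hμ => ?_
    rcases hsep μ hμ with h | h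
    · rw [weight_add_smul, weight_add_smul, weight_eq_of_mem_minSet h hP.1]
      have := mul_le_mul_of_nonneg_left (hP.2 μ h) ht.le
      linarith
    · exact h.le
  refine ⟨t, hpos, Set.ext fun ν => ⟨fun hν => ?_, fun hν => ?_⟩⟩
  · have hle := hν.2 P hP.1.1
    rcases hsep ν (minimal_of_mem_minSet hpos hν) with h | h
    · rw [weight_add_smul, weight_add_smul, weight_eq_of_mem_minSet h hP.1] at hle
      exact mem_minSet_of_weight_le hP h (le_of_mul_le_mul_left (by linarith) ht)
    · exact absurd hle h.not_ge
  · refine mem_minSet_of_weight_le hPm hν.1.1 ?_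
    rw [weight_add_smul, weight_add_smul, weight_eq_of_mem_minSet hν.1 hP.1,
      weight_eq_of_mem_minSet hν hP]

end Weight

theorem finrank_vectorSpan_add_card_le {ι E : Type*} [Fintype ι] [NormedAddCommGroup E]
    [InnerProductSpace ℝ E] [FiniteDimensional ℝ E] {b : ι → E} (hb : LinearIndependent ℝ b)
    {S : Set E} (hS : ∀ i, ∀ x ∈ S, ∀ y ∈ S, inner ℝ (b i) x = inner ℝ (b i) y) :
    Module.finrank ℝ (vectorSpan ℝ S) + Fintype.card ι ≤ Module.finrank ℝ E := by
  have hle : vectorSpan ℝ S ≤ (Submodule.span ℝ (range b))ᗮ := by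
    refine Submodule.span_le.mpr ?_
    rintro _ ⟨x, hx, y, hy, rfl⟩
    refine (Submodule.mem_orthogonal _ _).mpr fun z hz => ?_
    refine Submodule.span_induction ?_ (by simp) (fun _ _ _ _ h₁ h₂ => ?_) (fun _ _ _ h => ?_) hz
    · rintro _ ⟨i, rfl⟩
      simp only [vsub_eq_sub, inner_sub_right, hS i x hx y hy, sub_self]
    · rw [inner_add_left, h₁, h₂, add_zero]
    · rw [inner_smul_left, h, mul_zero]
  have hrank := Submodule.finrank_mono hle
  have hcompl := (Submodule.span ℝ (range b)).finrank_add_finrank_orthogonal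
  rw [finrank_span_eq_card hb] at hcompl
  omega

/-- A lattice point as a point of Euclidean space. -/
def latticePoint {n : ℕ} (ν : Fin n → ℕ) : EuclideanSpace ℝ (Fin n) :=
  WithLp.toLp 2 fun l => (ν l : ℝ)

@[simp]
theorem latticePoint_apply {n : ℕ} (ν : Fin n → ℕ) (l : Fin n) : latticePoint ν l = ν l := rfl

theorem latticePoint_injective {n : ℕ} : Function.Injective (latticePoint (n := n)) :=
  fun μ ν h => funext fun l => by simpa using congrArg (fun x : EuclideanSpace ℝ _ => x l) h

theorem inner_latticePoint {n : ℕ} (u : EuclideanSpace ℝ (Fin n)) (ν : Fin n → ℕ) :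
    inner ℝ u (latticePoint ν) = weight u ν := by
  simp [PiLp.inner_apply, weight, mul_comm]

section Facet

variable {n : ℕ} {A V : Set (Fin n → ℕ)} {u w : Fin n → ℝ} {P Q ν : Fin n → ℕ}

theorem weight_eq_of_collinear (hV : Collinear ℝ (latticePoint '' V)) (hP : P ∈ V) (hQ : Q ∈ V)
    (hPQ : P ≠ Q) (hν : ν ∈ V) (hw : weight w P = weight w Q) : weight w ν = weight w P := by
  have hmem := hV.mem_affineSpan_of_mem_of_ne ⟨P, hP, rfl⟩ ⟨Q, hQ, rfl⟩ ⟨ν, hν, rfl⟩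
    (latticePoint_injective.ne hPQ)
  obtain ⟨r, hr⟩ := mem_affineSpan_pair_iff_exists_lineMap_eq.mp hmem
  have hinner := inner_latticePoint (WithLp.toLp 2 w)
  have hline := congrArg (inner ℝ (WithLp.toLp 2 w)) hr
  simpa only [AffineMap.lineMap_apply, vsub_eq_sub, vadd_eq_add, inner_add_right,
    inner_smul_right, inner_sub_right, hinner, hw, sub_self, mul_zero, zero_add, eq_comm]
    using hline

/-- The positive weight `u` selects a set of points of `A` that is not contained in a line. For
`n = 3` this says that it selects a compact two-dimensional face of the Newton polyhedron. -/
structure IsFacet (A : Set (Fin n → ℕ)) (u : Fin n → ℝ) : Prop where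
  pos : ∀ l, 0 < u l
  not_collinear : ¬ Collinear ℝ (latticePoint '' minSet A u)

theorem isFacet_of_weight_ne (hu : ∀ l, 0 < u l) (hP : P ∈ minSet A u) (hQ : Q ∈ minSet A u)
    (hPQ : P ≠ Q) (hν : ν ∈ minSet A u) (hw : weight w P = weight w Q)
    (hne : weight w ν ≠ weight w P) : IsFacet A u :=
  ⟨hu, fun h => hne (weight_eq_of_collinear h hP hQ hPQ hν hw)⟩

theorem IsFacet.exists_ne (h : IsFacet A u) (P Q : Fin n → ℕ) :
    ∃ ν ∈ minSet A u, ν ≠ P ∧ ν ≠ Q := by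
  by_contra! hc
  refine h.not_collinear ((collinear_pair ℝ (latticePoint P) (latticePoint Q)).subset ?_)
  rintro _ ⟨ν, hν, rfl⟩
  by_cases hνP : ν = P
  · exact .inl (congrArg _ hνP)
  · exact .inr (congrArg _ (hc ν hν hνP))

/-- Turning the supporting plane about the line `PQ`. -/
theorem mem_minSet_add_smul_or_exists_isFacet {T : ℝ} (hu : ∀ l, 0 < u l) (hT : 0 < T)
    (huT : ∀ l, 0 ≤ (u + T • w) l) (hP : P ∈ minSet A u) (hQ : Q ∈ minSet A u) (hPQ : P ≠ Q)
    (hw : weight w P = weight w Q) :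
    (P ∈ minSet A (u + T • w) ∧ Q ∈ minSet A (u + T • w)) ∨
      ∃ t : ℝ, 0 ≤ t ∧ IsFacet A (u + t • w) ∧ P ∈ minSet A (u + t • w) ∧
        Q ∈ minSet A (u + t • w) ∧ ∃ ν ∈ minSet A (u + t • w), weight w ν < weight w P := by
  have hQt : ∀ t : ℝ, P ∈ minSet A (u + t • w) → Q ∈ minSet A (u + t • w) :=
    fun t => mem_minSet_add_smul_of_weight_eq hP hQ hw.symm
  rcases mem_minSet_add_smul_or_exists_weight_lt hu hT huT hP with
    hPT | ⟨t, ht, hpos, hPt, ν, hν, hlt⟩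
  · exact .inl ⟨hPT, hQt T hPT⟩
  · exact .inr ⟨t, ht, isFacet_of_weight_ne hpos hPt (hQt t hPt) hPQ hν hw hlt.ne, hPt,
      hQt t hPt, ν, hν, hlt⟩

end Facet

/-- The indices `i, j, k` are distinct, hence all the indices in dimension three. -/
structure IsFrame (i j k : Fin 3) : Prop where
  ne_left : i ≠ j
  ne_outer : i ≠ k
  ne_right : j ≠ k

namespace IsFrame

variable {i j k : Fin 3}

theorem swap (h : IsFrame i j k) : IsFrame i k j := ⟨h.2, h.1, h.3.symm⟩

theorem rotate (h : IsFrame i j k) : IsFrame j k i := ⟨h.3, h.1.symm, h.2.symm⟩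

theorem eq_or_eq_or_eq (h : IsFrame i j k) (l : Fin 3) : l = i ∨ l = j ∨ l = k := by
  obtain ⟨h₁, h₂, h₃⟩ := h
  revert i j k l
  decide

theorem forall_iff (h : IsFrame i j k) {p : Fin 3 → Prop} : (∀ l, p l) ↔ p i ∧ p j ∧ p k := by
  refine ⟨fun hp => ⟨hp i, hp j, hp k⟩, fun ⟨hi, hj, hk⟩ l => ?_⟩
  rcases h.eq_or_eq_or_eq l with rfl | rfl | rfl <;> assumption

theorem sum_eq {M : Type*} [AddCommMonoid M] (h : IsFrame i j k) (g : Fin 3 → M) :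
    ∑ l, g l = g i + g j + g k := by
  have : (Finset.univ : Finset (Fin 3)) = {i, j, k} :=
    Finset.ext fun l => by simpa using h.eq_or_eq_or_eq l
  rw [this, Finset.sum_insert (by simp [h.ne_left, h.ne_outer]), Finset.sum_pair h.ne_right,
    add_assoc]

theorem weight_eq (h : IsFrame i j k) (u : Fin 3 → ℝ) (ν : Fin 3 → ℕ) :
    weight u ν = u i * ν i + u j * ν j + u k * ν k :=
  h.sum_eq _

theorem ext {α : Type*} (h : IsFrame i j k) {μ ν : Fin 3 → α} (hi : μ i = ν i) (hj : μ j = ν j)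
    (hk : μ k = ν k) : μ = ν :=
  funext (h.forall_iff.mpr ⟨hi, hj, hk⟩)

theorem exists_eq {α : Type*} (h : IsFrame i j k) (a b c : α) :
    ∃ g : Fin 3 → α, g i = a ∧ g j = b ∧ g k = c :=
  ⟨fun l => if l = i then a else if l = j then b else c, by simp, by simp [h.ne_left.symm],
    by simp [h.ne_outer.symm, h.ne_right.symm]⟩

theorem finRange_perm (h : IsFrame i j k) : (List.finRange 3).Perm [i, j, k] := by
  obtain ⟨h₁, h₂, h₃⟩ := h
  revert i j k
  decide

end IsFrame

theorem exists_isFrame (i : Fin 3) : ∃ j k, IsFrame i j k := by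
  have : ∃ j k : Fin 3, i ≠ j ∧ i ≠ k ∧ j ≠ k := by revert i; decide
  obtain ⟨j, k, h₁, h₂, h₃⟩ := this
  exact ⟨j, k, h₁, h₂, h₃⟩

theorem exists_isFrame_of_ne {j k : Fin 3} (h : j ≠ k) : ∃ i, IsFrame i j k := by
  have : ∃ i : Fin 3, i ≠ j ∧ i ≠ k := by revert j k; decide
  obtain ⟨i, hj, hk⟩ := this
  exact ⟨i, hj, hk, h⟩

section Space

variable {A : Set (Fin 3 → ℕ)} {u : Fin 3 → ℝ} {μ ν : Fin 3 → ℕ}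

theorem finrank_vectorSpan_le_one (hu : ∀ l, 0 < u l) {c : ℝ} {j : Fin 3}
    {S : Set (EuclideanSpace ℝ (Fin 3))} (hS : ∀ x ∈ S, inner ℝ (WithLp.toLp 2 u) x = c)
    (hj : ∀ x ∈ S, x j = 0) : Module.finrank ℝ (vectorSpan ℝ S) ≤ 1 := by
  obtain ⟨i, k, hf⟩ := exists_isFrame j
  have hli : LinearIndependent ℝ
      ![(WithLp.toLp 2 u : EuclideanSpace ℝ (Fin 3)), EuclideanSpace.single j 1] := by
    refine LinearIndependent.pair_iff.mpr fun s t hst => ?_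
    have hi := congrArg (fun x : EuclideanSpace ℝ (Fin 3) => x i) hst
    have hs : s = 0 := by simpa [hf.ne_left.symm, (hu i).ne'] using hi
    have hj := congrArg (fun x : EuclideanSpace ℝ (Fin 3) => x j) hst
    exact ⟨hs, by simpa [hs] using hj⟩
  have := finrank_vectorSpan_add_card_le hli (S := S) fun l x hx y hy => by
    fin_cases l
    · exact (hS x hx).trans (hS y hy).symm
    · simp [EuclideanSpace.inner_single_left, hj x hx, hj y hy]
  simpa using this

theorem IsFacet.exists_apply_ne_zero (h : IsFacet A u) (j : Fin 3) :
    ∃ ν ∈ minSet A u, ν j ≠ 0 := by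
  by_contra! hc
  rcases (minSet A u).eq_empty_or_nonempty with hemp | ⟨P, hP⟩
  · exact h.not_collinear (by simpa [hemp] using collinear_empty ℝ _)
  refine h.not_collinear (collinear_iff_finrank_le_one.mpr
    (finrank_vectorSpan_le_one h.pos (c := weight u P) (j := j) ?_ ?_))
  · rintro _ ⟨ν, hν, rfl⟩
    exact (inner_latticePoint _ ν).trans (weight_eq_of_mem_minSet hν hP)
  · rintro _ ⟨ν, hν, rfl⟩
    simpa using hc ν hν

theorem eq_of_mem_minSet {i j k : Fin 3} (hf : IsFrame i j k) (hi : 0 < u i)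
    (hμ : μ ∈ minSet A u) (hν : ν ∈ minSet A u) (hj : μ j = ν j) (hk : μ k = ν k) : μ = ν := by
  have hw := weight_eq_of_mem_minSet hμ hν
  rw [hf.weight_eq, hf.weight_eq, hj, hk] at hw
  have : (μ i : ℝ) = ν i := mul_left_cancel₀ hi.ne' (by linarith)
  exact hf.ext (by exact_mod_cast this) hj hk

end Space

/-- The minimal points other than `P` lie in `x_j = 0`, and `P` lies at height one over that
hyperplane: the face selected by `u` is a pyramid of height one with apex `P`. -/
structure IsApex {n : ℕ} (A : Set (Fin n → ℕ)) (u : Fin n → ℝ) (j : Fin n) (P : Fin n → ℕ) :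
    Prop where
  mem : P ∈ minSet A u
  apply_eq_one : P j = 1
  apply_eq_zero : ∀ ν ∈ minSet A u, ν ≠ P → ν j = 0

theorem IsApex.eq_of_apply_ne_zero {n : ℕ} {A : Set (Fin n → ℕ)} {u : Fin n → ℝ} {j : Fin n}
    {P ν : Fin n → ℕ} (h : IsApex A u j P) (hν : ν ∈ minSet A u) (hj : ν j ≠ 0) : ν = P :=
  not_not.mp fun hne => hj (h.apply_eq_zero ν hν hne)

/-- The face selected by `u` is a pyramid of height one over a base in `x_j = 0`, with its apex
in another coordinate plane `x_k = 0`. For a facet this is exceptionality with respect to the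
axis along which neither `x_j` nor `x_k` varies. -/
def IsExceptionalWeight (A : Set (Fin 3 → ℕ)) (u : Fin 3 → ℝ) : Prop :=
  ∃ j k P, j ≠ k ∧ IsApex A u j P ∧ P k = 0

/-- The points `P = e_j + e_k` and `W` on the axis `OX_i` span an edge, along which `x_j = x_k`. -/
structure IsDiagonalEdge (A : Set (Fin 3 → ℕ)) (i j k : Fin 3) (s : Fin 3 → ℝ)
    (P W : Fin 3 → ℕ) : Prop where
  frame : IsFrame i j k
  pos : ∀ l, 0 < s l
  left_mem : P ∈ minSet A s
  right_mem : W ∈ minSet A s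
  left_zero : P i = 0
  left_one : P j = 1
  left_one' : P k = 1
  right_zero : W j = 0
  right_zero' : W k = 0
  apply_eq : ∀ ν ∈ minSet A s, ν j = ν k

namespace IsDiagonalEdge

variable {A : Set (Fin 3 → ℕ)} {i j k : Fin 3} {s v : Fin 3 → ℝ} {P W μ ν : Fin 3 → ℕ}

theorem swap (h : IsDiagonalEdge A i j k s P W) : IsDiagonalEdge A i k j s P W :=
  ⟨h.frame.swap, h.pos, h.left_mem, h.right_mem, h.left_zero, h.left_one', h.left_one,
    h.right_zero', h.right_zero, fun ν hν => (h.apply_eq ν hν).symm⟩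

theorem add_eq (h : IsDiagonalEdge A i j k s P W) :
    s j + s k = W i * s i := by
  have := weight_eq_of_mem_minSet h.left_mem h.right_mem
  simpa [h.frame.weight_eq, h.left_zero, h.left_one, h.left_one', h.right_zero, h.right_zero',
    mul_comm] using this

theorem mul_lt_mul (h : IsDiagonalEdge A i j k s P W) (hv : ∀ l, 0 < v l)
    (hν : ν ∈ minSet A v) (hνk : ν k = 0) (hνj : ν j ≠ 0) :
    v j * (W i * s i) < weight v ν * s j := by
  have hνj' : (0 : ℝ) < ν j := by exact_mod_cast Nat.pos_of_ne_zero hνj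
  have hs : W i * s i < ν i * s i + ν j * s j := by
    have : weight s W < weight s ν := not_le.mp fun hle =>
      hνj ((h.apply_eq ν (mem_minSet_of_weight_le h.right_mem hν.1 hle)).trans hνk)
    simpa [h.frame.weight_eq, h.right_zero, h.right_zero', hνk, mul_comm] using this
  have hvν : weight v ν = v i * ν i + v j * ν j := by simp [h.frame.weight_eq, hνk]
  have hle : weight v ν ≤ v i * W i := by
    simpa [h.frame.weight_eq v W, h.right_zero, h.right_zero'] using hν.2 W h.right_mem.1
  have hpos : 0 < weight v ν := by
    have := mul_nonneg (hv i).le (Nat.cast_nonneg (α := ℝ) (ν i))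
    linarith [mul_pos (hv j) hνj']
  refine lt_of_mul_lt_mul_left ?_ hνj'.le
  calc ν j * (v j * (W i * s i)) = (weight v ν * W i - ν i * (v i * W i)) * s i := by
        rw [hvν]; ring
    _ ≤ (weight v ν * W i - ν i * weight v ν) * s i := by
        have := (h.pos i).le
        gcongr
    _ = weight v ν * (W i * s i - ν i * s i) := by ring
    _ < weight v ν * (ν j * s j) := mul_lt_mul_of_pos_left (by linarith) hpos
    _ = ν j * (weight v ν * s j) := by ring

theorem not_meets_both (h : IsDiagonalEdge A i j k s P W)
    (hv : ∀ l, 0 < v l) (hν : ν ∈ minSet A v) (hνk : ν k = 0) (hνj : ν j ≠ 0)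
    (hμ : μ ∈ minSet A v) (hμj : μ j = 0) : μ k = 0 := by
  by_contra hμk
  have hsum := add_lt_add (h.mul_lt_mul hv hν hνk hνj)
    (h.swap.mul_lt_mul hv hμ hμj hμk)
  rw [weight_eq_of_mem_minSet hμ hν, ← h.add_eq, ← add_mul, ← mul_add] at hsum
  have hle : weight v ν ≤ v j + v k := by
    simpa [h.frame.weight_eq v P, h.left_zero, h.left_one, h.left_one'] using hν.2 P h.left_mem.1
  exact absurd hle (not_le.mpr
    (lt_of_mul_lt_mul_right hsum (add_pos (h.pos j) (h.pos k)).le))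

theorem isApex (h : IsDiagonalEdge A i j k s P W) (hv : IsFacet A v)
    (hk : ∀ ν ∈ minSet A v, ν k = 0 → ν j = 0) : IsApex A v j P := by
  have hbase : ∀ ν ∈ minSet A v, ν ≠ P → ν j = 0 := by
    intro ν hν hne
    by_contra hνj
    have hνk : ν k ≠ 0 := fun hνk => hνj (hk ν hν hνk)
    have hle : P ≤ ν := by
      refine h.frame.forall_iff.mpr ⟨?_, ?_, ?_⟩ <;>
        simp only [h.left_zero, h.left_one, h.left_one'] <;> omega
    exact (weight_strictMono hv.pos (lt_of_le_of_ne hle hne.symm)).not_ge (hν.2 P h.left_mem.1)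
  obtain ⟨ρ, hρ, hρj⟩ := hv.exists_apply_ne_zero j
  have hρP : ρ = P := not_not.mp fun hne => hρj (hbase ρ hρ hne)
  exact ⟨hρP ▸ hρ, h.left_one, hbase⟩

theorem isExceptionalWeight (h : IsDiagonalEdge A i j k s P W)
    (hv : IsFacet A v) : IsExceptionalWeight A v := by
  by_cases hk : ∀ ν ∈ minSet A v, ν k = 0 → ν j = 0
  · exact ⟨j, i, P, h.frame.ne_left.symm, h.isApex hv hk, h.left_zero⟩
  · push Not at hk
    obtain ⟨ν, hν, hνk, hνj⟩ := hk
    exact ⟨k, i, P, h.frame.ne_outer.symm, h.swap.isApex hv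
      fun μ hμ hμj => h.not_meets_both hv.pos hν hνk hνj hμ hμj, h.left_zero⟩

end IsDiagonalEdge

/-- The properties of the support of an isolated singularity that matter for its Newton
diagram. -/
structure IsolatedSupport (A : Set (Fin 3 → ℕ)) : Prop where
  order : ∀ ν ∈ A, 2 ≤ ∑ l, ν l
  near_axis : ∀ i j k : Fin 3, IsFrame i j k → ∃ ν ∈ A, ν j + ν k ≤ 1
  meets_plane : ∀ i, ∃ ν ∈ A, ν i = 0

/-- The segment `PQ` is an edge joining the coordinate planes `x_j = 0` and `x_k = 0` off the
axis `OX_i` in which they meet, and one of its ends is at distance one from this axis. -/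
structure IsBridge (A : Set (Fin 3 → ℕ)) (i j k : Fin 3) (s : Fin 3 → ℝ) (P Q : Fin 3 → ℕ) :
    Prop where
  frame : IsFrame i j k
  pos : ∀ l, 0 < s l
  minSet_eq : minSet A s = {P, Q}
  left_zero : P j = 0
  left_pos : 0 < P k
  right_zero : Q k = 0
  right_pos : 0 < Q j
  near : P k = 1 ∨ Q j = 1

/-- The face selected by `u` has a vertex on the axis `OX_i` or a bridge over it as an edge. -/
def TouchesAxis (A : Set (Fin 3 → ℕ)) (i : Fin 3) (u : Fin 3 → ℝ) : Prop :=
  (∃ W ∈ minSet A u, ∀ l, l ≠ i → W l = 0) ∨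
    ∃ j k s P Q, IsBridge A i j k s P Q ∧ P ∈ minSet A u ∧ Q ∈ minSet A u

section Bridge

variable {A : Set (Fin 3 → ℕ)} {i j k : Fin 3} {s v : Fin 3 → ℝ} {P Q R Y ν : Fin 3 → ℕ}

theorem IsolatedSupport.two_le (hA : IsolatedSupport A) (hf : IsFrame i j k) (hν : ν ∈ A) :
    2 ≤ ν i + ν j + ν k :=
  hf.sum_eq ν ▸ hA.order ν hν

theorem exists_isBridge_of_isApex (hf : IsFrame i j k) (hv : ∀ l, 0 < v l) (hP : IsApex A v k P)
    (hPj : P j = 0) (hY : Y ∈ minSet A v) (hYj : 0 < Y j) :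
    ∃ s Z, IsBridge A i j k s P Z ∧ Y j ≤ Z j := by
  obtain ⟨Z, hZ, hmax⟩ := exists_max_image (minSet A v) (fun ν => ν j) (minSet_finite hv) ⟨Y, hY⟩
  have hZj : 0 < Z j := hYj.trans_le (hmax Y hY)
  have hZP : Z ≠ P := by rintro rfl; omega
  have hZk := hP.apply_eq_zero Z hZ hZP
  obtain ⟨w, hwi, hwj, hwk⟩ := hf.exists_eq 0 (-1) (-(Z j : ℝ))
  have hwP : weight w P = -Z j := by simp [hf.weight_eq, hwi, hwk, hPj, hP.apply_eq_one]
  have hw : ∀ ν ∈ minSet A v, ν ≠ P → weight w ν = -ν j := fun ν hν hne => by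
    simp [hf.weight_eq, hwi, hwj, hP.apply_eq_zero ν hν hne]
  have hle : ∀ ν ∈ minSet A v, weight w P ≤ weight w ν := by
    intro ν hν
    rcases eq_or_ne ν P with rfl | hne
    · rfl
    · rw [hwP, hw ν hν hne]
      exact neg_le_neg (by exact_mod_cast hmax ν hν)
  obtain ⟨t, hpos, hmin⟩ := exists_minSet_add_smul_eq (A := A) hv w
  refine ⟨_, Z, ⟨hf, hpos, hmin.trans (Set.ext fun ν => ⟨fun ⟨hν, hν'⟩ => ?_, ?_⟩), hPj,
    by simp [hP.apply_eq_one], hZk, hZj, .inl hP.apply_eq_one⟩, hmax Y hY⟩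
  · refine or_iff_not_imp_left.mpr fun hne => ?_
    have hνj : Z j ≤ ν j := by
      have := hν' P hP.mem
      rw [hwP, hw ν hν hne] at this
      exact_mod_cast neg_le_neg_iff.mp this
    exact eq_of_mem_minSet hf (hv i) hν hZ (le_antisymm (hmax ν hν) hνj)
      ((hP.apply_eq_zero ν hν hne).trans hZk.symm)
  · rintro (rfl | rfl)
    · exact ⟨hP.mem, hle⟩
    · exact ⟨hZ, fun μ hμ => (hw _ hZ hZP).trans hwP.symm ▸ hle μ hμ⟩

namespace IsBridge

theorem symm (h : IsBridge A i j k s P Q) : IsBridge A i k j s Q P :=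
  ⟨h.frame.swap, h.pos, h.minSet_eq.trans (pair_comm P Q), h.right_zero, h.right_pos,
    h.left_zero, h.left_pos, h.near.symm⟩

theorem left_mem (h : IsBridge A i j k s P Q) : P ∈ minSet A s := by simp [h.minSet_eq]

theorem right_mem (h : IsBridge A i j k s P Q) : Q ∈ minSet A s := by simp [h.minSet_eq]

theorem ne (h : IsBridge A i j k s P Q) : P ≠ Q := by
  rintro rfl
  exact h.left_pos.ne' h.right_zero

theorem isDiagonalEdge (h : IsBridge A i j k s P Q) (hPi : P i = 1) (hPk : P k = 1)
    (hQi : Q i = 0) : IsDiagonalEdge A j i k s P Q where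
  frame := h.frame.swap.rotate.rotate
  pos := h.pos
  left_mem := h.left_mem
  right_mem := h.right_mem
  left_zero := h.left_zero
  left_one := hPi
  left_one' := hPk
  right_zero := hQi
  right_zero' := h.right_zero
  apply_eq := by
    rw [h.minSet_eq]
    rintro ν (rfl | rfl)
    · rw [hPi, hPk]
    · rw [hQi, h.right_zero]

theorem exists_maximal (h : IsBridge A i j k s P Q) :
    ∃ s P Q, IsBridge A i j k s P Q ∧
      ∀ s' P' Q', IsBridge A i j k s' P' Q' → P' k + Q' j ≤ P k + Q j := by
  have hfin : {p : (Fin 3 → ℕ) × (Fin 3 → ℕ) | ∃ s, IsBridge A i j k s p.1 p.2}.Finite :=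
    ((finite_minimal A).prod (finite_minimal A)).subset fun p ⟨_, hp⟩ =>
      ⟨minimal_of_mem_minSet hp.pos hp.left_mem, minimal_of_mem_minSet hp.pos hp.right_mem⟩
  obtain ⟨⟨P', Q'⟩, ⟨s', h'⟩, hmax⟩ :=
    exists_max_image _ (fun p => p.1 k + p.2 j) hfin ⟨(P, Q), s, h⟩
  exact ⟨s', P', Q', h', fun s₁ P₁ Q₁ h₁ => hmax (P₁, Q₁) ⟨s₁, h₁⟩⟩

theorem apply_pos_of_mem_minSet (hA : IsolatedSupport A) (h : IsBridge A i j k s P Q)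
    (hvi : 0 < v i) (hvj : v j = 0) (hvk : 0 ≤ v k) (hP : P ∈ minSet A v) (hQ : Q ∈ minSet A v) :
    0 < v k := by
  refine hvk.lt_of_ne' fun hvk => ?_
  have hweight : ∀ ν, weight v ν = v i * ν i := fun ν => by
    simp [h.frame.weight_eq, hvj, hvk]
  obtain ⟨ν, hν, hνi⟩ := hA.meets_plane i
  have apply_eq_zero : ∀ {ρ}, ρ ∈ minSet A v → ρ i = 0 := fun {ρ} hρ => by
    have := hρ.2 ν hν
    rw [hweight, hweight, hνi, Nat.cast_zero, mul_zero] at this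
    exact_mod_cast le_antisymm (nonpos_of_mul_nonpos_right this hvi) (Nat.cast_nonneg (ρ i))
  have hPi := apply_eq_zero hP
  have hQi := apply_eq_zero hQ
  have hP2 := hA.two_le h.frame hP.1
  have hQ2 := hA.two_le h.frame hQ.1
  have hPj := h.left_zero
  have hQk := h.right_zero
  have hnear := h.near
  omega

theorem notMem_minSet_of_apply_eq_zero (hA : IsolatedSupport A)
    (hdiag : ∀ i j k s P W, ¬ IsDiagonalEdge A i j k s P W) (h : IsBridge A i j k s P Q)
    (hvi : 0 < v i) (hvj : v j = 0) (hvk : 0 ≤ v k) (hP : P ∈ minSet A v) :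
    Q ∉ minSet A v := by
  intro hQ
  replace hvk : 0 < v k := h.apply_pos_of_mem_minSet hA hvi hvj hvk hP hQ
  have hweight : ∀ ν, weight v ν = v i * ν i + v k * ν k := fun ν => by
    simp [h.frame.weight_eq, hvj]
  have hPQ : v i * P i + v k * P k = v i * Q i := by
    simpa [hweight, h.right_zero] using weight_eq_of_mem_minSet hP hQ
  obtain ⟨ν, hν, hle⟩ := hA.near_axis j k i h.frame.rotate
  have hPν := hP.2 ν hν
  rw [hweight, hweight] at hPν
  have hPk : (1 : ℝ) ≤ P k := by exact_mod_cast h.left_pos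
  have hP2 := hA.two_le h.frame hP.1
  have hPj := h.left_zero
  have hcases : (ν i = 0 ∧ ν k = 0) ∨ (ν i = 1 ∧ ν k = 0) ∨ (ν i = 0 ∧ ν k = 1) := by omega
  rcases hcases with ⟨hνi, hνk⟩ | ⟨hνi, hνk⟩ | ⟨hνi, hνk⟩ <;>
    simp only [hνi, hνk, Nat.cast_zero, Nat.cast_one, mul_zero, mul_one, add_zero,
      zero_add] at hPν
  · nlinarith [(P i).cast_nonneg (α := ℝ)]
  · have hQi : (Q i : ℝ) ≤ 1 := le_of_mul_le_mul_left (by linarith) hvi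
    have hPi : (P i : ℝ) < Q i := lt_of_mul_lt_mul_left (by nlinarith) hvi.le
    norm_cast at hQi hPi
    have hnear := h.near
    exact hdiag _ _ _ _ _ _ (h.symm.isDiagonalEdge (by omega) (by omega) (by omega))
  · have hPk1 : (P k : ℝ) ≤ 1 := le_of_mul_le_mul_left (by nlinarith) hvk
    have hPi0 : (P i : ℝ) ≤ 0 := nonpos_of_mul_nonpos_right (by nlinarith) hvi
    norm_cast at hPk1 hPi0
    omega

theorem exists_isFacet_of_le (hA : IsolatedSupport A)
    (hdiag : ∀ i j k s P W, ¬ IsDiagonalEdge A i j k s P W) (h : IsBridge A i j k s P Q)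
    (hle : s j * Q j ≤ s k * P k) :
    ∃ v, IsFacet A v ∧ P ∈ minSet A v ∧ Q ∈ minSet A v ∧
      ∀ Y ∈ minSet A v, Y ≠ P → Y ≠ Q → P k * Q j < P k * Y j + Q j * Y k := by
  have hPk : (0 : ℝ) < P k := by exact_mod_cast h.left_pos
  obtain ⟨w, hwi, hwj, hwk⟩ := h.frame.exists_eq 0 (-(P k : ℝ)) (-(Q j : ℝ))
  have hw : ∀ ν, weight w ν = -(P k * ν j + Q j * ν k : ℝ) := fun ν => by
    rw [h.frame.weight_eq, hwi, hwj, hwk]; ring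
  have hwPQ : weight w P = weight w Q := by
    rw [hw, hw, h.left_zero, h.right_zero]
    push_cast
    ring
  have hT : 0 < s j / P k := div_pos (h.pos j) hPk
  have hTi : (s + (s j / P k) • w) i = s i := by simp [hwi]
  have hTj : (s + (s j / P k) • w) j = 0 := by simp [hwj, hPk.ne']
  have hTk : 0 ≤ (s + (s j / P k) • w) k := by
    simp only [Pi.add_apply, Pi.smul_apply, smul_eq_mul, hwk]
    rw [mul_neg, ← sub_eq_add_neg, sub_nonneg, div_mul_eq_mul_div, div_le_iff₀ hPk]
    exact hle
  rcases mem_minSet_add_smul_or_exists_isFacet h.pos hT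
    (h.frame.forall_iff.mpr ⟨hTi ▸ (h.pos i).le, hTj.ge, hTk⟩) h.left_mem h.right_mem h.ne hwPQ
    with ⟨hP, hQ⟩ | ⟨t, ht, hv, hP, hQ, -⟩
  · exact absurd hQ
      (h.notMem_minSet_of_apply_eq_zero hA hdiag (hTi ▸ h.pos i) hTj hTk hP)
  · refine ⟨_, hv, hP, hQ, fun Y hY hYP hYQ => ?_⟩
    have hYw := weight_lt_of_mem_minSet_add_smul ht h.left_mem hP hY
      (by simp [h.minSet_eq, hYP, hYQ])
    rw [hw, hw, h.left_zero, neg_lt_neg_iff] at hYw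
    have : (P k * Q j : ℝ) < P k * Y j + Q j * Y k := by simpa [mul_comm] using hYw
    exact_mod_cast this

theorem exists_isFacet (hA : IsolatedSupport A)
    (hdiag : ∀ i j k s P W, ¬ IsDiagonalEdge A i j k s P W) (h : IsBridge A i j k s P Q) :
    ∃ v, IsFacet A v ∧ P ∈ minSet A v ∧ Q ∈ minSet A v ∧
      ∀ Y ∈ minSet A v, Y ≠ P → Y ≠ Q → P k * Q j < P k * Y j + Q j * Y k := by
  rcases le_total (s j * Q j) (s k * P k) with hle | hle
  · exact h.exists_isFacet_of_le hA hdiag hle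
  · obtain ⟨v, hv, hQ, hP, hY⟩ := h.symm.exists_isFacet_of_le hA hdiag hle
    refine ⟨v, hv, hP, hQ, fun Y hYm hYP hYQ => ?_⟩
    have := hY Y hYm hYQ hYP
    rwa [mul_comm (P k) (Q j), add_comm (P k * Y j)]

theorem exists_lt_of_isApex (h : IsBridge A i j k s P Q) (hv : IsFacet A v)
    (hP : P ∈ minSet A v)
    (hY : ∀ Y ∈ minSet A v, Y ≠ P → Y ≠ Q → P k * Q j < P k * Y j + Q j * Y k)
    (hR : IsApex A v k R) : ∃ s' Z, IsBridge A i j k s' P Z ∧ Q j < Z j := by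
  obtain rfl := hR.eq_of_apply_ne_zero hP h.left_pos.ne'
  obtain ⟨Y, hYm, hYP, hYQ⟩ := hv.exists_ne P Q
  have hlt : Q j < Y j := by
    simpa [hR.apply_eq_one, hR.apply_eq_zero Y hYm hYP] using hY Y hYm hYP hYQ
  obtain ⟨s', Z, hb, hZ⟩ :=
    exists_isBridge_of_isApex h.frame hv.pos hR h.left_zero hYm (Nat.zero_lt_of_lt hlt)
  exact ⟨s', Z, hb, hlt.trans_le hZ⟩

theorem not_isApex_of_right_eq_zero (hA : IsolatedSupport A)
    (hdiag : ∀ i j k s P W, ¬ IsDiagonalEdge A i j k s P W) (h : IsBridge A i j k s P Q)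
    (hP : P ∈ minSet A v) (hQi : Q i = 0) : ¬ IsApex A v i R := by
  intro hR
  have hP2 := hA.two_le h.frame h.left_mem.1
  have hQ2 := hA.two_le h.frame h.right_mem.1
  have hP0 := h.left_zero
  have hQ0 := h.right_zero
  have hPk : P k = 1 := by have := h.near; omega
  obtain rfl := hR.eq_of_apply_ne_zero hP (by omega)
  exact hdiag _ _ _ _ _ _ (h.isDiagonalEdge hR.apply_eq_one hPk hQi)

theorem not_isApex (hA : IsolatedSupport A)
    (hdiag : ∀ i j k s P W, ¬ IsDiagonalEdge A i j k s P W) (h : IsBridge A i j k s P Q)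
    (hP : P ∈ minSet A v) (hQ : Q ∈ minSet A v) : ¬ IsApex A v i R := by
  intro hR
  by_cases hQR : Q = R
  · exact h.symm.not_isApex_of_right_eq_zero hA hdiag hQ
      (hR.apply_eq_zero P hP (hQR ▸ h.ne)) hR
  · exact h.not_isApex_of_right_eq_zero hA hdiag hP (hR.apply_eq_zero Q hQ hQR) hR

theorem exists_touchesAxis (hA : IsolatedSupport A)
    (hdiag : ∀ i j k s P W, ¬ IsDiagonalEdge A i j k s P W) (h : IsBridge A i j k s P Q) :
    ∃ u, IsFacet A u ∧ ¬ IsExceptionalWeight A u ∧ TouchesAxis A i u := by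
  obtain ⟨s, P, Q, h, hmax⟩ := h.exists_maximal
  obtain ⟨v, hv, hP, hQ, hY⟩ := h.exists_isFacet hA hdiag
  refine ⟨v, hv, ?_, .inr ⟨j, k, s, P, Q, h, hP, hQ⟩⟩
  rintro ⟨l, -, R, -, hR, -⟩
  rcases h.frame.eq_or_eq_or_eq l with rfl | rfl | rfl
  · exact h.not_isApex hA hdiag hP hQ hR
  · obtain ⟨s', Z, hb, hlt⟩ := h.symm.exists_lt_of_isApex hv hQ (fun Y hYm hYQ hYP => by
      rw [mul_comm, add_comm]; exact hY Y hYm hYP hYQ) hR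
    have := hmax _ _ _ hb.symm
    omega
  · obtain ⟨s', Z, hb, hlt⟩ := h.exists_lt_of_isApex hv hP hY hR
    have := hmax _ _ _ hb
    omega

end IsBridge

end Bridge

section AxisDisjoint

variable {A : Set (Fin 3 → ℕ)} {i j k : Fin 3} {P Q : Fin 3 → ℕ}

theorem minSet_eq_pair {n : ℕ} {A : Set (Fin n → ℕ)} {u : Fin n → ℝ} {P Q : Fin n → ℕ}
    (hP : P ∈ A) (hQ : Q ∈ A) (hPQ : weight u P = weight u Q)
    (hlt : ∀ ν ∈ A, ν ≠ P → ν ≠ Q → weight u P < weight u ν) : minSet A u = {P, Q} := by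
  have hPm : P ∈ minSet A u := ⟨hP, fun ν hν => by
    rcases eq_or_ne ν P with rfl | hνP
    · rfl
    rcases eq_or_ne ν Q with rfl | hνQ
    exacts [hPQ.le, (hlt ν hν hνP hνQ).le]⟩
  refine Subset.antisymm (fun ν hν => ?_)
    (pair_subset hPm (mem_minSet_of_weight_le hPm hQ hPQ.ge))
  by_contra hne
  obtain ⟨hνP, hνQ⟩ := not_or.mp hne
  exact (hlt ν hν.1 hνP hνQ).not_ge (hν.2 P hP)

theorem exists_weight_lt_of_forall_le (hf : IsFrame i j k) (hPj : P j = 0)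
    (hPk : P k = 1) (hQj : 0 < Q j) (hQk : Q k = 0)
    (hP : ∀ ν ∈ A, ν j = 0 → ν k = 1 → P i ≤ ν i)
    (hQ : ∀ ν ∈ A, ν k = 0 → Q j < ν j ∨ ν j = Q j ∧ Q i ≤ ν i) :
    ∃ s : Fin 3 → ℝ, (∀ l, 0 < s l) ∧ weight s P = weight s Q ∧
      ∀ ν ∈ A, ν ≠ P → ν ≠ Q → weight s P < weight s ν := by
  -- The slope `t` has to dominate the values of `x_i` at `P` and `Q`.
  set t : ℝ := Q i + 2 * P i + 1
  have : (0 : ℝ) ≤ P i := Nat.cast_nonneg _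
  have : (0 : ℝ) ≤ Q i := Nat.cast_nonneg _
  have ht : 0 < t := by positivity
  have htd : t ≤ t * Q j := le_mul_of_one_le_right ht.le (by exact_mod_cast hQj)
  obtain ⟨s, hsi, hsj, hsk⟩ := hf.exists_eq 1 t (t * Q j + Q i - P i)
  have : P i < s k := by linarith
  have hweight : ∀ ν, weight s ν = ν i + t * ν j + s k * ν k := fun ν => by
    rw [hf.weight_eq, hsi, hsj, one_mul]
  have hwP : weight s P = t * Q j + Q i := by simp [hweight, hPj, hPk, hsk]
  have hwQ : weight s Q = t * Q j + Q i := by simp [hweight, hQk, add_comm]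
  refine ⟨s, hf.forall_iff.mpr ⟨by simp [hsi], by rwa [hsj], by linarith⟩,
    hwP.trans hwQ.symm, fun ν hν hνP hνQ => ?_⟩
  have : (0 : ℝ) ≤ ν i := Nat.cast_nonneg _
  have hνj : 0 ≤ t * ν j := by positivity
  rw [hwP, hweight]
  obtain hνk | hνk | hνk : ν k = 0 ∨ ν k = 1 ∨ 2 ≤ ν k := by omega
  · rcases hQ ν hν hνk with hlt | ⟨heq, hle⟩
    · have : t * (Q j + 1) ≤ t * ν j := by gcongr; exact_mod_cast hlt
      simp only [hνk, Nat.cast_zero]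
      linarith
    · have : (Q i : ℝ) < ν i := by
        exact_mod_cast hle.lt_of_ne fun h => hνQ (hf.ext h.symm heq (hνk.trans hQk.symm))
      simp only [hνk, heq, Nat.cast_zero]
      linarith
  · simp only [hνk, hsk, Nat.cast_one]
    rcases (ν j).eq_zero_or_pos with h0 | hpos
    · have : (P i : ℝ) < ν i := by
        exact_mod_cast (hP ν hν h0 hνk).lt_of_ne fun h =>
          hνP (hf.ext h.symm (h0.trans hPj.symm) (hνk.trans hPk.symm))
      linarith
    · have : t ≤ t * ν j := le_mul_of_one_le_right ht.le (by exact_mod_cast hpos)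
      linarith
  · have : s k * 2 ≤ s k * ν k := by gcongr; exacts [by linarith, by exact_mod_cast hνk]
    linarith

theorem exists_isBridge_of_axis_disjoint (hf : IsFrame i j k) (hA : ∃ ν ∈ A, ν k = 0)
    (hdisj : ∀ ν ∈ A, ν k = 0 → 0 < ν j) (hP : ∃ P ∈ A, P j = 0 ∧ P k = 1) :
    ∃ s P Q, IsBridge A i j k s P Q := by
  obtain ⟨P, ⟨hPA, hPj, hPk⟩, hPmin⟩ := exists_minimalFor_of_wellFoundedLT
    (fun ν => ν ∈ A ∧ ν j = 0 ∧ ν k = 1) (fun ν => ν i) hP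
  obtain ⟨Q, ⟨hQA, hQk⟩, hQmin⟩ := exists_minimalFor_of_wellFoundedLT
    (fun ν => ν ∈ A ∧ ν k = 0) (fun ν => toLex (ν j, ν i)) hA
  have hQj := hdisj Q hQA hQk
  obtain ⟨s, hs, heq, hlt⟩ := exists_weight_lt_of_forall_le hf hPj hPk hQj hQk
    (fun ν hν hνj hνk => (le_total _ _).elim id (hPmin ⟨hν, hνj, hνk⟩))
    (fun ν hν hνk => by
      have := (le_total _ _).elim id (hQmin (j := ν) ⟨hν, hνk⟩)
      simpa only [Prod.Lex.toLex_le_toLex, eq_comm (a := Q j)] using this)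
  exact ⟨s, P, Q, hf, hs, minSet_eq_pair hPA hQA heq hlt, hPj, hPk ▸ one_pos, hQk, hQj, .inl hPk⟩

end AxisDisjoint

section AxisMet

variable {A : Set (Fin 3 → ℕ)} {i j k : Fin 3} {s u v : Fin 3 → ℝ} {R V W : Fin 3 → ℕ}

theorem apply_eq_one_of_weight_eq_zero (hA : IsolatedSupport A) (hf : IsFrame i j k)
    (hui : 0 < u i) (huj : 0 ≤ u j) (huk : u k = 0) (hW : W ∈ minSet A u) (hWj : W j = 0)
    (hWi : 2 ≤ W i) (hV : V ∈ minSet A u) (hVj : 0 < V j) : V j = 1 ∧ V i = 0 := by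
  have hweight : ∀ ν, weight u ν = u i * ν i + u j * ν j := fun ν => by
    simp [hf.weight_eq, huk]
  obtain ⟨ν, hν, hνij⟩ := hA.near_axis k i j hf.rotate.rotate
  have hWν := hW.2 ν hν
  have hWV := weight_eq_of_mem_minSet hW hV
  rw [hweight, hweight, hWj, Nat.cast_zero, mul_zero, add_zero] at hWν hWV
  have hi : u i * 2 ≤ u i * W i := by gcongr; exact_mod_cast hWi
  have huν : u i * W i ≤ u j := by
    obtain ⟨h₁, h₂⟩ | ⟨h₁, h₂⟩ | ⟨h₁, h₂⟩ :
        (ν i = 0 ∧ ν j = 0) ∨ (ν i = 1 ∧ ν j = 0) ∨ (ν i = 0 ∧ ν j = 1) := by omega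
    all_goals
      simp only [h₁, h₂, Nat.cast_zero, Nat.cast_one] at hWν
      linarith
  have hj : u j * 1 ≤ u j * V j := by gcongr; exact_mod_cast hVj
  constructor
  · by_contra hne
    have : u j * 2 ≤ u j * V j := by gcongr; exact_mod_cast (by omega : 2 ≤ V j)
    linarith [mul_nonneg hui.le (Nat.cast_nonneg (α := ℝ) (V i))]
  · by_contra hne
    have : u i * 1 ≤ u i * V i := by gcongr; exact_mod_cast Nat.pos_of_ne_zero hne
    linarith

theorem exists_isFacet_of_mem_minSet_of_mem_minSet (hA : IsolatedSupport A) (hf : IsFrame i j k)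
    (hs : ∀ l, 0 < s l) (hW : W ∈ minSet A s) (hW0 : ∀ l, l ≠ i → W l = 0) (hWi : 2 ≤ W i)
    (hV : V ∈ minSet A s) (hVj : 0 < V j) :
    (V j = 1 ∧ V i = 0) ∨ ∃ v, IsFacet A v ∧ W ∈ minSet A v ∧ V ∈ minSet A v ∧
      ∃ ν ∈ minSet A v, V k * ν j < V j * ν k := by
  have hWj := hW0 j hf.ne_left.symm
  have hWk := hW0 k hf.ne_outer.symm
  have hVj' : (0 : ℝ) < V j := by exact_mod_cast hVj
  obtain ⟨w, hwi, hwj, hwk⟩ := hf.exists_eq 0 (V k : ℝ) (-(V j : ℝ))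
  have hweight : ∀ ν, weight w ν = V k * ν j - V j * ν k := fun ν => by
    rw [hf.weight_eq, hwi, hwj, hwk]; ring
  have hwW : weight w W = 0 := by simp [hweight, hWj, hWk]
  have hwV : weight w V = 0 := by rw [hweight]; ring
  have hTk : (s + (s k / V j) • w) k = 0 := by simp [hwk, hVj'.ne']
  have hTi : 0 < (s + (s k / V j) • w) i := by simpa [hwi] using hs i
  have hTj : 0 ≤ (s + (s k / V j) • w) j := by
    have := hs j
    have := hs k
    simp only [Pi.add_apply, Pi.smul_apply, smul_eq_mul, hwj]
    positivity
  rcases mem_minSet_add_smul_or_exists_isFacet hs (div_pos (hs k) hVj')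
    (hf.forall_iff.mpr ⟨hTi.le, hTj, hTk.ge⟩) hW hV (by rintro rfl; omega)
    (hwW.trans hwV.symm) with ⟨hWT, hVT⟩ | ⟨t, -, hv, hWt, hVt, ν, hν, hlt⟩
  · exact .inl (apply_eq_one_of_weight_eq_zero hA hf hTi hTj hTk hWT hWj hWi hVT hVj)
  · rw [hwW, hweight, sub_neg] at hlt
    exact .inr ⟨_, hv, hWt, hVt, ν, hν, by exact_mod_cast hlt⟩

theorem exists_mem_minSet_of_forall_axis_le (hf : IsFrame i j k) (hW : W ∈ A)
    (hW0 : ∀ l, l ≠ i → W l = 0) (hmin : ∀ ν ∈ A, (∀ l, l ≠ i → ν l = 0) → W i ≤ ν i)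
    (hA : ∃ ν ∈ A, ν i = 0) (hWi : 0 < W i) :
    ∃ s, (∀ l, 0 < s l) ∧ W ∈ minSet A s ∧ ∃ V ∈ minSet A s, 0 < V j + V k := by
  have hWj := hW0 j hf.ne_left.symm
  have hWk := hW0 k hf.ne_outer.symm
  have hm : (0 : ℝ) < W i := by exact_mod_cast hWi
  obtain ⟨u, hui, huj, huk⟩ := hf.exists_eq 1 (W i : ℝ) (W i : ℝ)
  obtain ⟨w, hwi, hwj, hwk⟩ := hf.exists_eq (0 : ℝ) (-1) (-1)
  have hu : ∀ l, 0 < u l := hf.forall_iff.mpr ⟨by simp [hui], by rwa [huj], by rwa [huk]⟩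
  have hweight_u : ∀ ν, weight u ν = ν i + W i * (ν j + ν k : ℕ) := fun ν => by
    rw [hf.weight_eq, hui, huj, huk]; push_cast; ring
  have hweight_w : ∀ ν, weight w ν = -(ν j + ν k : ℕ) := fun ν => by
    rw [hf.weight_eq, hwi, hwj, hwk]; push_cast; ring
  have hWu : W ∈ minSet A u := by
    refine ⟨hW, fun ν hν => ?_⟩
    have hle : W i ≤ ν i + W i * (ν j + ν k) := by
      rcases (ν j + ν k).eq_zero_or_pos with h0 | hpos
      · obtain ⟨hj, hk⟩ := Nat.add_eq_zero_iff.mp h0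
        exact le_add_right (hmin ν hν
          (hf.forall_iff.mpr ⟨fun h => absurd rfl h, fun _ => hj, fun _ => hk⟩))
      · exact le_add_left (Nat.le_mul_of_pos_right _ hpos)
    rw [hweight_u, hweight_u, hWj, hWk]
    exact_mod_cast hle
  have hT : ∀ l, (u + (W i : ℝ) • w) l = if l = i then 1 else 0 := hf.forall_iff.mpr
    ⟨by simp [hui, hwi], by simp [huj, hwj, hf.ne_left.symm], by simp [huk, hwk, hf.ne_outer.symm]⟩
  rcases mem_minSet_add_smul_or_exists_weight_lt hu hm (fun l => by rw [hT]; positivity) hWu with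
    hWT | ⟨t, -, hpos, hWt, V, hV, hlt⟩
  · obtain ⟨ν, hν, hνi⟩ := hA
    have := hWT.2 ν hν
    simp [hf.weight_eq, hT, hνi, hf.ne_left.symm, hf.ne_outer.symm, hWi.ne'] at this
  · refine ⟨_, hpos, hWt, V, hV, ?_⟩
    rw [hweight_w, hweight_w, hWj, hWk] at hlt
    exact_mod_cast neg_lt_neg_iff.mp hlt

theorem IsolatedSupport.exists_isFacet_of_mem_axis (hA : IsolatedSupport A)
    (hdiag : ∀ i j k s P W, ¬ IsDiagonalEdge A i j k s P W) (hf : IsFrame i j k) (hW : W ∈ A)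
    (hW0 : ∀ l, l ≠ i → W l = 0) (hmin : ∀ ν ∈ A, (∀ l, l ≠ i → ν l = 0) → W i ≤ ν i)
    (hWi : 2 ≤ W i) : ∃ v, IsFacet A v ∧ W ∈ minSet A v := by
  have hWj := hW0 j hf.ne_left.symm
  have hWk := hW0 k hf.ne_outer.symm
  obtain ⟨s, hs, hWs, V, hV, hVjk⟩ :=
    exists_mem_minSet_of_forall_axis_le hf hW hW0 hmin (hA.meets_plane i) (by omega)
  by_contra! hno
  have hj : 0 < V j → V j = 1 ∧ V i = 0 := fun hVj =>
    (exists_isFacet_of_mem_minSet_of_mem_minSet hA hf hs hWs hW0 hWi hV hVj).resolve_right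
      fun ⟨v, hv, hWv, _⟩ => hno v hv hWv
  have hk : 0 < V k → V k = 1 ∧ V i = 0 := fun hVk =>
    (exists_isFacet_of_mem_minSet_of_mem_minSet hA hf.swap hs hWs hW0 hWi hV hVk).resolve_right
      fun ⟨v, hv, hWv, _⟩ => hno v hv hWv
  have hV2 := hA.two_le hf hV.1
  obtain ⟨hVi, hVj, hVk⟩ : V i = 0 ∧ V j = 1 ∧ V k = 1 := by omega
  obtain ⟨w, hwi, hwj, hwk⟩ := hf.exists_eq (0 : ℝ) 1 (-1)
  have hweight : ∀ ν, weight w ν = ν j - ν k := fun ν => by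
    rw [hf.weight_eq, hwi, hwj, hwk]; ring
  have hwW : weight w W = 0 := by simp [hweight, hWj, hWk]
  have hwV : weight w V = 0 := by simp [hweight, hVj, hVk]
  refine hdiag i j k s V W ⟨hf, hs, hV, hWs, hVi, hVj, hVk, hWj, hWk, fun ν hν => ?_⟩
  by_contra hne
  refine hno s (isFacet_of_weight_ne hs hWs hV (by rintro rfl; omega) hν (hwW.trans hwV.symm) ?_)
    hWs
  rw [hwW, hweight, sub_ne_zero]
  exact_mod_cast hne

theorem exists_isDiagonalEdge_of_isApex (hf : IsFrame i j k) (hv : ∀ l, 0 < v l)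
    (hW : W ∈ minSet A v) (hWj : W j = 0) (hWk : W k = 0) (hR : IsApex A v k R) (hRi : R i = 0)
    (hRj : R j = 1) : ∃ s, IsDiagonalEdge A i j k s R W := by
  obtain ⟨w, hwi, hwj, hwk⟩ := hf.exists_eq (0 : ℝ) 1 (-1)
  have hweight : ∀ ν, weight w ν = ν j - ν k := fun ν => by
    rw [hf.weight_eq, hwi, hwj, hwk]; ring
  have hwR : weight w R = 0 := by simp [hweight, hRj, hR.apply_eq_one]
  have hwW : weight w W = 0 := by simp [hweight, hWj, hWk]
  have hWm : W ∈ minSet (minSet A v) w := by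
    refine ⟨hW, fun ν hν => ?_⟩
    rcases eq_or_ne ν R with rfl | hne
    · rw [hwW, hwR]
    · simp [hwW, hweight, hR.apply_eq_zero ν hν hne]
  obtain ⟨t, hpos, hmin⟩ := exists_minSet_add_smul_eq (A := A) hv w
  rw [← hmin] at hWm
  have hRm : R ∈ minSet A (v + t • w) :=
    hmin ▸ mem_minSet_of_weight_le (hmin ▸ hWm) hR.mem (by rw [hwR, hwW])
  refine ⟨_, hf, hpos, hRm, hWm, hRi, hRj, hR.apply_eq_one, hWj, hWk, fun ν hν => ?_⟩
  have := weight_eq_of_mem_minSet (hmin ▸ hν) (hmin ▸ hWm)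
  rw [hwW, hweight, sub_eq_zero] at this
  exact_mod_cast this

theorem exists_isBridge_of_isFacet (hf : IsFrame i j k) (hv : IsFacet A v)
    (hW : W ∈ minSet A v) (hWj : W j = 0) (hWk : W k = 0) (hR : IsApex A v k R) (hRj : R j = 0) :
    ∃ s Z, IsBridge A i j k s R Z := by
  obtain ⟨Y, hY, hYW, hYR⟩ := hv.exists_ne W R
  have hYk := hR.apply_eq_zero Y hY hYR
  have hYj : Y j ≠ 0 := fun h =>
    hYW (eq_of_mem_minSet hf (hv.pos i) hY hW (h.trans hWj.symm) (hYk.trans hWk.symm))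
  obtain ⟨s, Z, h, -⟩ := exists_isBridge_of_isApex hf hv.pos hR hRj hY (Nat.pos_of_ne_zero hYj)
  exact ⟨s, Z, h⟩

theorem not_isExceptionalWeight_of_mul_lt {ν : Fin 3 → ℕ} (hf : IsFrame i j k)
    (hW : W ∈ minSet A v) (hWi : 2 ≤ W i) (hR : R ∈ minSet A v) (hRj : 2 ≤ R j) (hRk : R k ≠ 0)
    (hν : ν ∈ minSet A v) (hlt : R k * ν j < R j * ν k) : ¬ IsExceptionalWeight A v := by
  rintro ⟨l, -, P, -, hP, -⟩
  have hPl := hP.apply_eq_one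
  rcases hf.eq_or_eq_or_eq l with rfl | rfl | rfl
  · obtain rfl := hP.eq_of_apply_ne_zero hW (by omega)
    omega
  · obtain rfl := hP.eq_of_apply_ne_zero hR (by omega)
    omega
  · obtain rfl := hP.eq_of_apply_ne_zero hR hRk
    obtain rfl := hP.eq_of_apply_ne_zero hν (by rintro h; simp [h] at hlt)
    exact hlt.ne (mul_comm _ _)

theorem IsApex.exists_touchesAxis (hA : IsolatedSupport A)
    (hdiag : ∀ i j k s P W, ¬ IsDiagonalEdge A i j k s P W) (hf : IsFrame i j k)
    (hv : IsFacet A v) (hW : W ∈ minSet A v) (hW0 : ∀ l, l ≠ i → W l = 0) (hWi : 2 ≤ W i)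
    (hR : IsApex A v k R) (hRij : R i = 0 ∨ R j = 0) :
    ∃ u, IsFacet A u ∧ ¬ IsExceptionalWeight A u ∧ TouchesAxis A i u := by
  have hWj := hW0 j hf.ne_left.symm
  have hWk := hW0 k hf.ne_outer.symm
  rcases (R j).eq_zero_or_pos with hRj | hRj
  · obtain ⟨s, Z, h⟩ := exists_isBridge_of_isFacet hf hv hW hWj hWk hR hRj
    exact h.exists_touchesAxis hA hdiag
  have hRj1 : R j ≠ 1 := fun hRj1 => by
    obtain ⟨s, h⟩ := exists_isDiagonalEdge_of_isApex hf hv.pos hW hWj hWk hR (by omega) hRj1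
    exact hdiag _ _ _ _ _ _ h
  rcases exists_isFacet_of_mem_minSet_of_mem_minSet hA hf hv.pos hW hW0 hWi hR.mem hRj with
    ⟨h, -⟩ | ⟨u, hu, hWu, hRu, ν, hν, hlt⟩
  · exact absurd h hRj1
  · exact ⟨u, hu, not_isExceptionalWeight_of_mul_lt hf hWu hWi hRu (by omega)
      (by simp [hR.apply_eq_one]) hν hlt, .inl ⟨W, hWu, hW0⟩⟩

theorem IsolatedSupport.exists_touchesAxis_of_mem_axis (hA : IsolatedSupport A)
    (hdiag : ∀ i j k s P W, ¬ IsDiagonalEdge A i j k s P W)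
    (hW : ∃ W ∈ A, ∀ l, l ≠ i → W l = 0) :
    ∃ u, IsFacet A u ∧ ¬ IsExceptionalWeight A u ∧ TouchesAxis A i u := by
  obtain ⟨W, ⟨hW, hW0⟩, hWmin⟩ := exists_minimalFor_of_wellFoundedLT
    (fun ν => ν ∈ A ∧ ∀ l, l ≠ i → ν l = 0) (fun ν => ν i) hW
  obtain ⟨j, k, hf⟩ := exists_isFrame i
  have hWi : 2 ≤ W i := by
    simpa [hW0 j hf.ne_left.symm, hW0 k hf.ne_outer.symm] using hA.two_le hf hW
  obtain ⟨v, hv, hWv⟩ := hA.exists_isFacet_of_mem_axis hdiag hf hW hW0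
    (fun ν hν hν0 => (le_total _ _).elim id (hWmin ⟨hν, hν0⟩)) hWi
  by_cases hexc : IsExceptionalWeight A v
  · obtain ⟨k, l, R, hkl, hR, hRl⟩ := hexc
    have hik : i ≠ k := by
      rintro rfl
      obtain rfl := hR.eq_of_apply_ne_zero hWv (by omega)
      have := hR.apply_eq_one
      omega
    obtain ⟨j, hf⟩ := exists_isFrame_of_ne hik
    refine hR.exists_touchesAxis hA hdiag hf.rotate.swap hv hWv hW0 hWi ?_
    rcases hf.eq_or_eq_or_eq l with rfl | rfl | rfl
    exacts [.inr hRl, .inl hRl, absurd rfl hkl]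
  · exact ⟨v, hv, hexc, .inl ⟨W, hWv, hW0⟩⟩

end AxisMet

theorem IsolatedSupport.exists_touchesAxis {A : Set (Fin 3 → ℕ)} {v : Fin 3 → ℝ}
    (hA : IsolatedSupport A) (hv : IsFacet A v) (hexc : ¬ IsExceptionalWeight A v) (i : Fin 3) :
    ∃ u, IsFacet A u ∧ ¬ IsExceptionalWeight A u ∧ TouchesAxis A i u := by
  have hdiag : ∀ i j k s P W, ¬ IsDiagonalEdge A i j k s P W :=
    fun _ _ _ _ _ _ h => hexc (h.isExceptionalWeight hv)
  by_cases haxis : ∃ W ∈ A, ∀ l, l ≠ i → W l = 0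
  · exact hA.exists_touchesAxis_of_mem_axis hdiag haxis
  obtain ⟨j, k, hf⟩ := exists_isFrame i
  have hdisj : ∀ ν ∈ A, ν j = 0 → ν k ≠ 0 := fun ν hν hj hk =>
    haxis ⟨ν, hν, hf.forall_iff.mpr ⟨fun h => absurd rfl h, fun _ => hj, fun _ => hk⟩⟩
  obtain ⟨P, hP, hPjk⟩ := hA.near_axis i j k hf
  obtain ⟨hPj, hPk⟩ | ⟨hPj, hPk⟩ : (P j = 0 ∧ P k = 1) ∨ (P j = 1 ∧ P k = 0) := by
    have := hdisj P hP
    omega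
  · obtain ⟨s, P, Q, h⟩ := exists_isBridge_of_axis_disjoint hf (hA.meets_plane k)
      (fun ν hν hk => Nat.pos_of_ne_zero fun hj => hdisj ν hν hj hk) ⟨P, hP, hPj, hPk⟩
    exact h.exists_touchesAxis hA hdiag
  · obtain ⟨s, P, Q, h⟩ := exists_isBridge_of_axis_disjoint hf.swap (hA.meets_plane j)
      (fun ν hν hj => Nat.pos_of_ne_zero (hdisj ν hν hj)) ⟨P, hP, hPk, hPj⟩
    exact h.exists_touchesAxis hA hdiag

section ConvexHull

variable {E : Type*} [AddCommGroup E] [Module ℝ E] {s B : Set E}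

theorem eq_convexHull_inter_of_isExtreme (hB : IsExtreme ℝ (convexHull ℝ s) B)
    (hconv : Convex ℝ B) : B = convexHull ℝ (B ∩ s) := by
  refine Subset.antisymm (fun x hx => ?_) (convexHull_min inter_subset_left hconv)
  have hT : Convex ℝ {y | y ∈ convexHull ℝ s ∧ (y ∈ B → y ∈ convexHull ℝ (B ∩ s))} := by
    refine convex_iff_openSegment_subset.mpr fun y hy z hz w hw => ⟨?_, fun hwB => ?_⟩
    · exact (convex_convexHull ℝ s).openSegment_subset hy.1 hz.1 hw
    · exact (convex_convexHull ℝ _).openSegment_subset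
        (hy.2 (hB.left_mem_of_mem_openSegment hy.1 hz.1 hwB hw))
        (hz.2 (hB.right_mem_of_mem_openSegment hy.1 hz.1 hwB hw)) hw
  refine (convexHull_min (fun y hy => ?_) hT (hB.subset hx)).2 hx
  exact ⟨subset_convexHull ℝ s hy, fun hyB => subset_convexHull ℝ _ ⟨hyB, hy⟩⟩

theorem toExposed_convexHull [TopologicalSpace E] (ℓ : E →L[ℝ] ℝ)
    (s : Set E) : ℓ.toExposed (convexHull ℝ s) = convexHull ℝ (ℓ.toExposed s) := by
  have hexp : IsExposed ℝ (convexHull ℝ s) (ℓ.toExposed (convexHull ℝ s)) :=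
    ContinuousLinearMap.toExposed.isExposed
  rw [eq_convexHull_inter_of_isExtreme hexp.isExtreme (hexp.convex (convex_convexHull ℝ s))]
  congr 1
  refine Subset.antisymm (fun x hx => ⟨hx.2, fun y hy => hx.1.2 y (subset_convexHull ℝ s hy)⟩)
    fun x hx => ⟨⟨subset_convexHull ℝ s hx.1, fun y hy => ?_⟩, hx.1⟩
  exact convexHull_min hx.2 (convex_halfSpace_le ℓ.isLinear (ℓ x)) hy

end ConvexHull

section SupportSet

variable {n : ℕ}

theorem supportSet_eq_toExposed (u : EuclideanSpace ℝ (Fin n))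
    (S : Set (EuclideanSpace ℝ (Fin n))) : supportSet u S = (-innerSL ℝ u).toExposed S := by
  ext x
  simp [supportSet, ContinuousLinearMap.toExposed]

theorem isExposed_supportSet (u : EuclideanSpace ℝ (Fin n)) (S : Set (EuclideanSpace ℝ (Fin n))) :
    IsExposed ℝ S (supportSet u S) :=
  supportSet_eq_toExposed u S ▸ ContinuousLinearMap.toExposed.isExposed

theorem supportSet_convexHull (u : EuclideanSpace ℝ (Fin n))
    (S : Set (EuclideanSpace ℝ (Fin n))) :
    supportSet u (convexHull ℝ S) = convexHull ℝ (supportSet u S) := by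
  rw [supportSet_eq_toExposed, toExposed_convexHull, ← supportSet_eq_toExposed]

theorem mem_vertices_convexHull {u p : EuclideanSpace ℝ (Fin n)}
    {S : Set (EuclideanSpace ℝ (Fin n))} (h : supportSet u S = {p}) :
    p ∈ vertices (convexHull ℝ S) := by
  have hexp := (isExposed_supportSet u (convexHull ℝ S)).isExtreme
  rwa [supportSet_convexHull, h, convexHull_singleton, isExtreme_singleton] at hexp

theorem left_mem_vertices_segment {W Y : EuclideanSpace ℝ (Fin n)} (h : W ≠ Y) :
    W ∈ vertices (segment ℝ W Y) := by
  have hlt : inner ℝ (Y - W) W < inner ℝ (Y - W) Y := by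
    have := real_inner_self_pos.mpr (sub_ne_zero.mpr h.symm)
    rwa [inner_sub_right, sub_pos] at this
  rw [← convexHull_pair]
  refine mem_vertices_convexHull (u := Y - W) (Subset.antisymm ?_ ?_)
  · rintro x ⟨rfl | rfl, hmin⟩
    exacts [rfl, absurd (hmin W (by simp)) hlt.not_ge]
  · rintro _ rfl
    exact ⟨by simp, by rintro x (rfl | rfl); exacts [le_rfl, hlt.le]⟩

section Edge

variable {S : Set (EuclideanSpace ℝ (Fin n))} {W Y : EuclideanSpace ℝ (Fin n)}

theorem IsEdge.left_mem_vertices (h : IsEdge S W Y) : W ∈ vertices S :=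
  h.2.isExtreme.extremePoints_subset_extremePoints (left_mem_vertices_segment h.1)

theorem IsEdge.symm (h : IsEdge S W Y) : IsEdge S Y W :=
  ⟨h.1.symm, segment_symm ℝ W Y ▸ h.2⟩

end Edge

theorem dim_convexHull (S : Set (EuclideanSpace ℝ (Fin n))) :
    dim (convexHull ℝ S) = Module.finrank ℝ (vectorSpan ℝ S) := by
  rw [dim, ← direction_affineSpan, affineSpan_convexHull, direction_affineSpan]

end SupportSet

section Polyhedron

variable {n : ℕ} {A : Set (Fin n → ℕ)}

/-- The upper set of `ℝⁿ` generated by the lattice points of `A`. -/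
def upperHull (A : Set (Fin n → ℕ)) : Set (EuclideanSpace ℝ (Fin n)) :=
  {x | ∃ ν ∈ A, ∀ l, (ν l : ℝ) ≤ x l}

/-- The Newton polyhedron of a set of lattice points; the Newton diagram of a function is the
polyhedron of the support of its Taylor expansion. -/
def polyhedron (A : Set (Fin n → ℕ)) : Set (EuclideanSpace ℝ (Fin n)) :=
  convexHull ℝ (upperHull A)

/-- The face of the Newton polyhedron of `A` that is selected by `u`, as the convex hull of the
points of `A` on it. For this encoding to be right all the entries of `u` must be positive. -/
def face (A : Set (Fin n → ℕ)) (u : Fin n → ℝ) : Set (EuclideanSpace ℝ (Fin n)) :=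
  convexHull ℝ (latticePoint '' minSet A u)

theorem latticePoint_mem_face {u : Fin n → ℝ} {ν : Fin n → ℕ} (hν : ν ∈ minSet A u) :
    latticePoint ν ∈ face A u :=
  subset_convexHull ℝ _ (mem_image_of_mem _ hν)

section Weight

variable {u x : EuclideanSpace ℝ (Fin n)} {ν : Fin n → ℕ}

theorem weight_le_inner (hu : ∀ l, 0 ≤ u l) (hx : ∀ l, (ν l : ℝ) ≤ x l) :
    weight u ν ≤ inner ℝ u x := by
  simp only [PiLp.inner_apply, RCLike.inner_apply', conj_trivial]
  exact Finset.sum_le_sum fun l _ => mul_le_mul_of_nonneg_left (hx l) (hu l)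

theorem eq_latticePoint_of_inner_le (hu : ∀ l, 0 < u l) (hx : ∀ l, (ν l : ℝ) ≤ x l)
    (h : inner ℝ u x ≤ weight u ν) : x = latticePoint ν := by
  have hterm : ∀ l ∈ Finset.univ, u l * ν l ≤ u l * x l :=
    fun l _ => mul_le_mul_of_nonneg_left (hx l) (hu l).le
  have heq : weight u ν = ∑ l, u l * x l := by
    refine le_antisymm (Finset.sum_le_sum hterm) ?_
    simpa only [PiLp.inner_apply, RCLike.inner_apply', conj_trivial] using h
  ext l
  exact (mul_left_cancel₀ (hu l).ne'
    ((Finset.sum_eq_sum_iff_of_le hterm).mp heq l (Finset.mem_univ l))).symm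

theorem supportSet_upperHull (hu : ∀ l, 0 < u l) :
    supportSet u (upperHull A) = latticePoint '' minSet A u := by
  refine Subset.antisymm ?_ ?_
  · rintro x ⟨⟨ν, hν, hx⟩, hmin⟩
    have hle : ∀ μ ∈ A, inner ℝ u x ≤ weight u μ := fun μ hμ =>
      inner_latticePoint u μ ▸ hmin (latticePoint μ) ⟨μ, hμ, fun _ => le_rfl⟩
    refine ⟨ν, ⟨hν, fun μ hμ => (weight_le_inner (fun l => (hu l).le) hx).trans (hle μ hμ)⟩, ?_⟩
    exact (eq_latticePoint_of_inner_le hu hx (hle ν hν)).symm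
  · rintro _ ⟨ν, hν, rfl⟩
    refine ⟨⟨ν, hν.1, fun _ => le_rfl⟩, fun x hx => ?_⟩
    obtain ⟨μ, hμ, hx⟩ := hx
    exact inner_latticePoint u ν ▸ (hν.2 μ hμ).trans (weight_le_inner (fun l => (hu l).le) hx)

theorem supportSet_polyhedron (hu : ∀ l, 0 < u l) : supportSet u (polyhedron A) = face A u := by
  rw [polyhedron, supportSet_convexHull, supportSet_upperHull hu, face]

theorem add_single_mem_polyhedron (hx : x ∈ polyhedron A) (l : Fin n) {t : ℝ} (ht : 0 ≤ t) :
    x + EuclideanSpace.single l t ∈ polyhedron A := by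
  have hconv : Convex ℝ {y | y + EuclideanSpace.single l t ∈ polyhedron A} :=
    (convex_convexHull ℝ _).translate_preimage_left _
  refine convexHull_min ?_ hconv hx
  rintro y ⟨ν, hν, hy⟩
  refine subset_convexHull ℝ _ ⟨ν, hν, fun i => (hy i).trans ?_⟩
  rw [PiLp.add_apply, le_add_iff_nonneg_right, PiLp.single_apply]
  split_ifs
  exacts [ht, le_rfl]

theorem pos_of_isCompact_supportSet (hu : ∀ l, 0 ≤ u l)
    (hne : (supportSet u (polyhedron A)).Nonempty)
    (hc : IsCompact (supportSet u (polyhedron A))) (l : Fin n) : 0 < u l := by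
  refine lt_of_le_of_ne (hu l) fun h0 => ?_
  obtain ⟨x, hx, hmin⟩ := hne
  obtain ⟨C, hC⟩ := hc.isBounded.exists_norm_le
  have hray : ∀ t : ℝ, 0 ≤ t → x + EuclideanSpace.single l t ∈ supportSet u (polyhedron A) := by
    refine fun t ht => ⟨add_single_mem_polyhedron hx l ht, fun w hw => ?_⟩
    simpa [inner_add_right, EuclideanSpace.inner_single_right, ← h0] using hmin w hw
  have hle : |x l + (|C| + |x l| + 1)| ≤ C := by
    simpa using (PiLp.norm_apply_le _ l).trans (hC _ (hray (|C| + |x l| + 1) (by positivity)))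
  linarith [le_abs_self (x l + (|C| + |x l| + 1)), neg_abs_le (x l), le_abs_self C]

end Weight

section Vertices

variable {u w : Fin n → ℝ} {P Q : Fin n → ℕ}

theorem isCompact_face (hu : ∀ l, 0 < u l) : IsCompact (face A u) :=
  ((minSet_finite hu).image _).isCompact_convexHull ℝ

theorem convexHull_vertices_face (hu : ∀ l, 0 < u l) :
    convexHull ℝ (vertices (face A u)) = face A u := by
  have hfin : (vertices (face A u)).Finite :=
    ((minSet_finite hu).image _).subset extremePoints_convexHull_subset
  rw [← (hfin.isClosed_convexHull ℝ).closure_eq]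
  exact closure_convexHull_extremePoints (isCompact_face hu) (convex_convexHull ℝ _)

theorem mem_image_of_mem_vertices_face {x : EuclideanSpace ℝ (Fin n)}
    (hx : x ∈ vertices (face A u)) : x ∈ latticePoint '' minSet A u :=
  extremePoints_convexHull_subset hx

theorem supportSet_image_latticePoint (w : Fin n → ℝ) (V : Set (Fin n → ℕ)) :
    supportSet (WithLp.toLp 2 w) (latticePoint '' V) = latticePoint '' minSet V w := by
  ext x
  constructor
  · rintro ⟨⟨ν, hν, rfl⟩, hmin⟩
    exact ⟨ν, ⟨hν, by simpa [inner_latticePoint] using hmin⟩, rfl⟩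
  · rintro ⟨ν, ⟨hν, hmin⟩, rfl⟩
    exact ⟨⟨ν, hν, rfl⟩, by simpa [inner_latticePoint] using hmin⟩

theorem latticePoint_mem_vertices (h : minSet (minSet A u) w = {P}) :
    latticePoint P ∈ vertices (face A u) :=
  mem_vertices_convexHull (u := WithLp.toLp 2 w) <| by
    rw [supportSet_image_latticePoint, h, image_singleton]

theorem isEdge_face (h : minSet (minSet A u) w = {P, Q}) (hPQ : P ≠ Q) :
    IsEdge (face A u) (latticePoint P) (latticePoint Q) := by
  refine ⟨latticePoint_injective.ne hPQ, ?_⟩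
  have hexp := isExposed_supportSet (WithLp.toLp 2 w) (face A u)
  rwa [face, supportSet_convexHull, supportSet_image_latticePoint, h, image_pair,
    convexHull_pair] at hexp

end Vertices

end Polyhedron

theorem dim_face_add_one_le {n : ℕ} {A : Set (Fin n → ℕ)} {u : Fin n → ℝ} (hu : u ≠ 0) :
    dim (face A u) + 1 ≤ n := by
  have hli : LinearIndependent ℝ fun _ : Unit => (WithLp.toLp 2 u : EuclideanSpace ℝ (Fin n)) :=
    LinearIndependent.of_subsingleton () (by simpa using hu)
  have h := finrank_vectorSpan_add_card_le hli (S := latticePoint '' minSet A u) ?_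
  · simpa [face, dim_convexHull] using h
  · rintro - _ ⟨μ, hμ, rfl⟩ _ ⟨ν, hν, rfl⟩
    rw [inner_latticePoint, inner_latticePoint]
    exact weight_eq_of_mem_minSet hμ hν

section Space

variable {A : Set (Fin 3 → ℕ)} {u : Fin 3 → ℝ} {i j k : Fin 3} {P : Fin 3 → ℕ}

theorem dim_face_eq_two_iff (hu : ∀ l, 0 < u l) : dim (face A u) = 2 ↔ IsFacet A u := by
  have hle := dim_face_add_one_le (A := A) (u := u) fun h => (hu 0).ne' (congrFun h 0)
  have hcol := collinear_iff_finrank_le_one (k := ℝ) (s := latticePoint '' minSet A u)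
  rw [← dim_convexHull, ← face] at hcol
  exact ⟨fun h => ⟨hu, fun hc => by have := hcol.mp hc; omega⟩,
    fun h => by have := mt hcol.mpr h.not_collinear; omega⟩

theorem infDist_axis (hf : IsFrame i j k) (x : EuclideanSpace ℝ (Fin 3)) :
    Metric.infDist x (axis i) = √(x j ^ 2 + x k ^ 2) := by
  have hdist : ∀ y ∈ axis i, dist x y = √((x i - y i) ^ 2 + x j ^ 2 + x k ^ 2) := fun y hy => by
    rw [EuclideanSpace.dist_eq, hf.sum_eq, hy j hf.ne_left.symm, hy k hf.ne_outer.symm]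
    simp [Real.dist_eq, sq_abs]
  have hproj : EuclideanSpace.single i (x i) ∈ axis i := fun l hl => by simp [hl]
  refine le_antisymm ?_ ((Metric.le_infDist ⟨_, hproj⟩).mpr fun y hy => ?_)
  · refine (Metric.infDist_le_dist_of_mem hproj).trans_eq ?_
    simp [hdist _ hproj]
  · rw [hdist y hy]
    exact Real.sqrt_le_sqrt (by linarith [sq_nonneg (x i - y i)])

theorem infDist_latticePoint_axis_eq_one_iff (hf : IsFrame i j k) :
    Metric.infDist (latticePoint P) (axis i) = 1 ↔
      (P j = 1 ∧ P k = 0) ∨ (P j = 0 ∧ P k = 1) := by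
  rw [infDist_axis hf, Real.sqrt_eq_one, latticePoint_apply, latticePoint_apply]
  have hcast : (P j : ℝ) ^ 2 + (P k : ℝ) ^ 2 = ((P j ^ 2 + P k ^ 2 : ℕ) : ℝ) := by push_cast; rfl
  rw [hcast, Nat.cast_eq_one, Nat.add_eq_one_iff]
  simp [or_comm]

theorem axis_subset_coordHyperplane_iff {n : ℕ} {i j : Fin n} :
    axis i ⊆ coordHyperplane j ↔ j ≠ i := by
  refine ⟨?_, fun h x hx => hx j h⟩
  rintro h rfl
  have hmem : EuclideanSpace.single j (1 : ℝ) ∈ axis j := fun l hl => by simp [hl]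
  simpa [coordHyperplane] using h hmem

theorem exists_eq_mul_of_mem_face {n : ℕ} {A : Set (Fin n → ℕ)} {u : Fin n → ℝ} {j : Fin n}
    {W x : EuclideanSpace ℝ (Fin n)} (hu : ∀ l, 0 < u l) (hW : W ∈ vertices (face A u))
    (hne : (vertices (face A u) \ {W}).Nonempty)
    (hsub : convexHull ℝ (vertices (face A u) \ {W}) ⊆ coordHyperplane j) (hx : x ∈ face A u) :
    ∃ t : ℝ, 0 ≤ t ∧ t ≤ 1 ∧ x j = t * W j ∧ (t = 1 → x = W) := by
  rw [← convexHull_vertices_face hu, ← insert_eq_of_mem hW, ← insert_sdiff_singleton,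
    convexHull_insert hne, mem_convexJoin] at hx
  obtain ⟨_, rfl, b, hb, t, r, ht, hr, htr, rfl⟩ := hx
  have hbj : b j = 0 := hsub hb
  refine ⟨t, ht, by linarith, by simp [hbj], fun h => ?_⟩
  rw [h, show r = 0 by linarith, one_smul, zero_smul, add_zero]

theorem isExceptionalWeight_of_isExceptionalWrt (hu : IsFacet A u)
    (h : IsExceptionalWrt (face A u) i) : IsExceptionalWeight A u := by
  obtain ⟨W, hW, hdist, -, hdim, j, hij, hsub⟩ := h
  obtain ⟨P, hP, rfl⟩ := mem_image_of_mem_vertices_face hW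
  obtain ⟨k, hf⟩ : ∃ k, IsFrame i j k := by
    obtain ⟨k, hf⟩ := exists_isFrame_of_ne (axis_subset_coordHyperplane_iff.mp hij)
    exact ⟨k, hf.rotate.rotate.swap⟩
  have hne : (vertices (face A u) \ {latticePoint P}).Nonempty := by
    refine nonempty_iff_ne_empty.mpr fun hempty => ?_
    rw [dim_convexHull, hempty, vectorSpan_empty, finrank_bot] at hdim
    omega
  have happly : ∀ ν ∈ minSet A u, ∃ t : ℝ, 0 ≤ t ∧ t ≤ 1 ∧ (ν j : ℝ) = t * P j ∧
      (t = 1 → latticePoint ν = latticePoint P) := fun ν hν =>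
    exists_eq_mul_of_mem_face hu.pos hW hne hsub (latticePoint_mem_face hν)
  rcases (infDist_latticePoint_axis_eq_one_iff hf).mp hdist with ⟨hPj, hPk⟩ | ⟨hPj, -⟩
  · refine ⟨j, k, P, hf.ne_right, ⟨hP, hPj, fun ν hν hνP => ?_⟩, hPk⟩
    obtain ⟨t, -, ht1, ht, hW⟩ := happly ν hν
    rw [hPj, Nat.cast_one, mul_one] at ht
    have hνj : ν j ≠ 1 := fun h => hνP (latticePoint_injective (hW (by simpa [h] using ht.symm)))
    have hle : ν j ≤ 1 := by exact_mod_cast ht.trans_le ht1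
    omega
  · obtain ⟨ν, hν, hne⟩ := hu.exists_apply_ne_zero j
    obtain ⟨t, -, -, ht, -⟩ := happly ν hν
    exact absurd (by simpa [hPj] using ht) hne

end Space

section Apex

variable {n : ℕ} {A : Set (Fin n → ℕ)} {u : Fin n → ℝ} {j : Fin n} {P : Fin n → ℕ}

theorem IsApex.mem_vertices (h : IsApex A u j P) : latticePoint P ∈ vertices (face A u) := by
  have hw : ∀ ν : Fin n → ℕ, weight (Pi.single j (-1)) ν = -ν j := fun ν => by
    simp [weight, Pi.single_apply]
  refine latticePoint_mem_vertices (w := Pi.single j (-1))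
    (Subset.antisymm (fun ν hν => ?_) (singleton_subset_iff.mpr ⟨h.mem, fun ν hν => ?_⟩))
  · refine h.eq_of_apply_ne_zero hν.1 fun hνj => ?_
    have := hν.2 P h.mem
    norm_num [hw, hνj, h.apply_eq_one] at this
  · rw [hw, hw, h.apply_eq_one, neg_le_neg_iff]
    rcases eq_or_ne ν P with rfl | hne
    · rw [h.apply_eq_one]
    · simp [h.apply_eq_zero ν hν hne]

theorem IsApex.vertices_sdiff_subset (h : IsApex A u j P) :
    vertices (face A u) \ {latticePoint P} ⊆ latticePoint '' {ν ∈ minSet A u | ν j = 0} := by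
  rintro x ⟨hx, hxP⟩
  obtain ⟨ν, hν, rfl⟩ := mem_image_of_mem_vertices_face hx
  exact ⟨ν, ⟨hν, h.apply_eq_zero ν hν fun hne => hxP (congrArg latticePoint hne)⟩, rfl⟩

theorem IsApex.convexHull_vertices_sdiff_subset (h : IsApex A u j P) :
    convexHull ℝ (vertices (face A u) \ {latticePoint P}) ⊆ coordHyperplane j := by
  refine convexHull_min (fun x hx => ?_)
    (convex_hyperplane (EuclideanSpace.projₗ (𝕜 := ℝ) j).isLinear 0)
  obtain ⟨ν, ⟨-, hν⟩, rfl⟩ := h.vertices_sdiff_subset hx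
  simp [coordHyperplane, hν]

theorem IsApex.isExposed_base (h : IsApex A u j P) (hu : ∀ l, 0 < u l)
    (hne : (vertices (face A u) \ {latticePoint P}).Nonempty) :
    IsExposed ℝ (face A u) (convexHull ℝ (vertices (face A u) \ {latticePoint P})) := by
  have hzero : ∀ x ∈ vertices (face A u) \ {latticePoint P}, x j = 0 := fun x hx =>
    h.convexHull_vertices_sdiff_subset (subset_convexHull ℝ _ hx)
  have hinner : ∀ x : EuclideanSpace ℝ (Fin n),
      inner ℝ (EuclideanSpace.single j (1 : ℝ)) x = x j := by
    simp [EuclideanSpace.inner_single_left]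
  have hbase : supportSet (EuclideanSpace.single j 1) (vertices (face A u)) =
      vertices (face A u) \ {latticePoint P} := by
    obtain ⟨b, hb⟩ := hne
    ext x
    refine ⟨fun ⟨hx, hmin⟩ => ⟨hx, ?_⟩, fun hx => ⟨hx.1, fun y hy => ?_⟩⟩
    · rintro rfl
      have hle := hmin b hb.1
      norm_num [hinner, hzero b hb, h.apply_eq_one] at hle
    · obtain ⟨ν, -, rfl⟩ := mem_image_of_mem_vertices_face hy
      simp [hinner, hzero x hx]
  have hexp := isExposed_supportSet (EuclideanSpace.single j 1) (face A u)
  rwa [← convexHull_vertices_face hu, supportSet_convexHull, hbase,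
    convexHull_vertices_face hu] at hexp

end Apex

section Exceptional

variable {A : Set (Fin 3 → ℕ)} {u s : Fin 3 → ℝ} {i j k : Fin 3} {P Q W : Fin 3 → ℕ}

theorem IsApex.dim_base (h : IsApex A u j P) (hu : IsFacet A u) :
    dim (convexHull ℝ (vertices (face A u) \ {latticePoint P})) = 1 := by
  have hle : dim (convexHull ℝ (vertices (face A u) \ {latticePoint P})) ≤ 1 := by
    rw [dim_convexHull]
    refine finrank_vectorSpan_le_one hu.pos (c := weight u P) (j := j) (fun x hx => ?_)
      fun x hx => h.convexHull_vertices_sdiff_subset (subset_convexHull ℝ _ hx)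
    obtain ⟨ν, hν, rfl⟩ := mem_image_of_mem_vertices_face hx.1
    exact (inner_latticePoint _ ν).trans (weight_eq_of_mem_minSet hν h.mem)
  have hface := (dim_face_eq_two_iff hu.pos).mpr hu
  have hinsert := finrank_vectorSpan_insert_le_set ℝ (vertices (face A u) \ {latticePoint P})
    (latticePoint P)
  rw [insert_sdiff_singleton, insert_eq_of_mem h.mem_vertices, ← dim_convexHull,
    ← dim_convexHull, convexHull_vertices_face hu.pos, hface] at hinsert
  omega

theorem exists_isExceptionalWrt_of_isExceptionalWeight (hu : IsFacet A u)
    (h : IsExceptionalWeight A u) : ∃ i, IsExceptionalWrt (face A u) i := by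
  obtain ⟨j, k, P, hjk, hP, hPk⟩ := h
  obtain ⟨i, hf⟩ := exists_isFrame_of_ne hjk
  have hdim := hP.dim_base hu
  have hne : (vertices (face A u) \ {latticePoint P}).Nonempty := by
    refine nonempty_iff_ne_empty.mpr fun hempty => ?_
    rw [dim_convexHull, hempty, vectorSpan_empty, finrank_bot] at hdim
    exact absurd hdim zero_ne_one
  exact ⟨i, latticePoint P, hP.mem_vertices,
    (infDist_latticePoint_axis_eq_one_iff hf).mpr (.inl ⟨hP.apply_eq_one, hPk⟩),
    hP.isExposed_base hu.pos hne, by rw [hdim], j,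
    axis_subset_coordHyperplane_iff.mpr hf.ne_left.symm, hP.convexHull_vertices_sdiff_subset⟩

theorem latticePoint_mem_vertices_of_axis (hu : ∀ l, 0 < u l) (hW : W ∈ minSet A u)
    (hax : ∀ l, l ≠ i → W l = 0) : latticePoint W ∈ vertices (face A u) := by
  obtain ⟨j, k, hf⟩ := exists_isFrame i
  obtain ⟨w, hwi, hwj, hwk⟩ := hf.exists_eq (0 : ℝ) 1 1
  have hWj := hax j hf.ne_left.symm
  have hWk := hax k hf.ne_outer.symm
  have hw : ∀ ν, weight w ν = ((ν j + ν k : ℕ) : ℝ) := fun ν => by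
    simp [hf.weight_eq, hwi, hwj, hwk]
  have hwW : weight w W = 0 := by simp [hw, hWj, hWk]
  refine latticePoint_mem_vertices (w := w) (Subset.antisymm (fun ν hν => ?_)
    (singleton_subset_iff.mpr ⟨hW, fun ν _ => hwW ▸ hw ν ▸ Nat.cast_nonneg _⟩))
  have hle : ν j + ν k ≤ 0 := by
    have := hwW ▸ hν.2 W hW
    rw [hw] at this
    exact_mod_cast this
  exact eq_of_mem_minSet hf (hu i) hν.1 hW (by omega) (by omega)

namespace IsBridge

theorem minSet_minSet_eq (h : IsBridge A i j k s P Q) (hP : P ∈ minSet A u) (hQ : Q ∈ minSet A u) :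
    minSet (minSet A u) s = {P, Q} := by
  refine Subset.antisymm (fun ν hν => h.minSet_eq ▸ ?_) ?_
  · exact mem_minSet_of_weight_le h.left_mem hν.1.1 (hν.2 P hP)
  · rintro ν (rfl | rfl)
    exacts [⟨hP, fun μ hμ => h.left_mem.2 μ hμ.1⟩, ⟨hQ, fun μ hμ => h.right_mem.2 μ hμ.1⟩]

theorem exists_isEdge (h : IsBridge A i j k s P Q) (hP : P ∈ minSet A u) (hQ : Q ∈ minSet A u)
    (hPk : P k = 1) :
    ∃ W ∈ vertices (face A u), ∃ Y ∈ vertices (face A u),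
      W ∈ coordPlane i k ∧ Metric.infDist W (axis i) = 1 ∧ Y ∈ coordPlane i j ∧
      IsEdge (face A u) W Y := by
  have hPplane : latticePoint P ∈ coordPlane i k := h.frame.forall_iff.mpr
    ⟨fun hi => absurd rfl hi, fun _ _ => by simp [h.left_zero], fun _ hk => absurd rfl hk⟩
  have hQplane : latticePoint Q ∈ coordPlane i j := h.frame.forall_iff.mpr
    ⟨fun hi => absurd rfl hi, fun _ hj => absurd rfl hj, fun _ _ => by simp [h.right_zero]⟩
  have hedge : IsEdge (face A u) _ _ := isEdge_face (h.minSet_minSet_eq hP hQ) h.ne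
  exact ⟨latticePoint P, hedge.left_mem_vertices, latticePoint Q, hedge.symm.left_mem_vertices,
    hPplane, (infDist_latticePoint_axis_eq_one_iff h.frame).mpr (.inr ⟨h.left_zero, hPk⟩),
    hQplane, hedge⟩

end IsBridge

theorem TouchesAxis.exists_vertex_or_exists_isEdge (h : TouchesAxis A i u) (hu : ∀ l, 0 < u l) :
    (∃ W ∈ axis i, W ∈ vertices (face A u)) ∨
      ∃ j k : Fin 3, j ≠ i ∧ k ≠ i ∧ j ≠ k ∧
        ∃ W ∈ vertices (face A u), ∃ Y ∈ vertices (face A u),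
          W ∈ coordPlane i j ∧ Metric.infDist W (axis i) = 1 ∧ Y ∈ coordPlane i k ∧
          IsEdge (face A u) W Y := by
  rcases h with ⟨W, hW, hax⟩ | ⟨j, k, s, P, Q, hb, hP, hQ⟩
  · exact .inl ⟨latticePoint W, fun l hl => by simp [hax l hl],
      latticePoint_mem_vertices_of_axis hu hW hax⟩
  · obtain ⟨hij, hik, hjk⟩ := hb.frame
    rcases hb.near with hPk | hQj
    · exact .inr ⟨k, j, hik.symm, hij.symm, hjk.symm, hb.exists_isEdge hP hQ hPk⟩
    · exact .inr ⟨j, k, hij.symm, hik.symm, hjk, hb.symm.exists_isEdge hQ hP hQj⟩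

end Exceptional

section PartialDerivatives

variable {n : ℕ} {f g : (Fin n → ℂ) → ℂ} {B : Set (Fin n → ℂ)}

theorem analyticOnNhd_partialDeriv (hf : AnalyticOnNhd ℂ f B) (i : Fin n) :
    AnalyticOnNhd ℂ (partialDeriv i f) B := fun z hz =>
  (ContinuousLinearMap.apply ℂ ℂ (Pi.single i 1 : Fin n → ℂ)).analyticAt _ |>.comp (hf.fderiv z hz)

theorem analyticOnNhd_iterate_partialDeriv (hf : AnalyticOnNhd ℂ f B) (i : Fin n) (a : ℕ) :
    AnalyticOnNhd ℂ ((partialDeriv i)^[a] f) B := by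
  induction a with
  | zero => exact hf
  | succ a ih => rw [Function.iterate_succ_apply']; exact analyticOnNhd_partialDeriv ih i

theorem analyticOnNhd_foldr_partialDeriv (hf : AnalyticOnNhd ℂ f B) (ν : Fin n → ℕ)
    (L : List (Fin n)) : AnalyticOnNhd ℂ (L.foldr (fun i g => (partialDeriv i)^[ν i] g) f) B := by
  induction L with
  | nil => exact hf
  | cons i L ih => exact analyticOnNhd_iterate_partialDeriv ih i _

theorem eqOn_partialDeriv (hB : IsOpen B) (h : EqOn f g B) (i : Fin n) :
    EqOn (partialDeriv i f) (partialDeriv i g) B := fun z hz => by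
  rw [partialDeriv, partialDeriv,
    Filter.EventuallyEq.fderiv_eq (h.eventuallyEq_of_mem (hB.mem_nhds hz))]

theorem eqOn_iterate_partialDeriv (hB : IsOpen B) (h : EqOn f g B) (i : Fin n) (a : ℕ) :
    EqOn ((partialDeriv i)^[a] f) ((partialDeriv i)^[a] g) B := by
  induction a with
  | zero => exact h
  | succ a ih =>
    rw [Function.iterate_succ_apply', Function.iterate_succ_apply']
    exact eqOn_partialDeriv hB ih i

theorem partialDeriv_partialDeriv (hf : AnalyticOnNhd ℂ f B) (i j : Fin n) {z : Fin n → ℂ}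
    (hz : z ∈ B) : partialDeriv i (partialDeriv j f) z =
      fderiv ℂ (fderiv ℂ f) z (Pi.single i 1) (Pi.single j 1) := by
  have hd : DifferentiableAt ℂ (fderiv ℂ f) z := (hf.fderiv z hz).differentiableAt
  change fderiv ℂ (fun w => fderiv ℂ f w (Pi.single j 1)) z (Pi.single i 1) = _
  simp [fderiv_clm_apply hd (differentiableAt_const _)]

theorem partialDeriv_comm (hf : AnalyticOnNhd ℂ f B) (i j : Fin n) :
    EqOn (partialDeriv i (partialDeriv j f)) (partialDeriv j (partialDeriv i f)) B := by
  intro z hz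
  have hsymm : IsSymmSndFDerivAt ℂ f z :=
    (hf z hz).contDiffAt.isSymmSndFDerivAt (n := ⊤) le_top
  rw [partialDeriv_partialDeriv hf i j hz, partialDeriv_partialDeriv hf j i hz, hsymm.eq]

theorem partialDeriv_iterate_partialDeriv_comm (hB : IsOpen B) (hf : AnalyticOnNhd ℂ f B)
    (i j : Fin n) (b : ℕ) :
    EqOn (partialDeriv i ((partialDeriv j)^[b] f)) ((partialDeriv j)^[b] (partialDeriv i f)) B := by
  induction b generalizing f with
  | zero => exact eqOn_refl _ _
  | succ b ih =>
    rw [Function.iterate_succ_apply, Function.iterate_succ_apply]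
    exact (ih (analyticOnNhd_partialDeriv hf j)).trans
      (eqOn_iterate_partialDeriv hB (partialDeriv_comm hf i j) j b)

theorem iterate_partialDeriv_comm (hB : IsOpen B) (hf : AnalyticOnNhd ℂ f B) (i j : Fin n)
    (a b : ℕ) : EqOn ((partialDeriv i)^[a] ((partialDeriv j)^[b] f))
      ((partialDeriv j)^[b] ((partialDeriv i)^[a] f)) B := by
  induction a with
  | zero => exact eqOn_refl _ _
  | succ a ih =>
    rw [Function.iterate_succ_apply', Function.iterate_succ_apply']
    exact (eqOn_partialDeriv hB ih i).trans (partialDeriv_iterate_partialDeriv_comm hB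
      (analyticOnNhd_iterate_partialDeriv hf i a) i j b)

theorem eqOn_foldr_partialDeriv_of_perm (hB : IsOpen B) (hf : AnalyticOnNhd ℂ f B)
    (ν : Fin n → ℕ) {L M : List (Fin n)} (h : L.Perm M) :
    EqOn (L.foldr (fun i g => (partialDeriv i)^[ν i] g) f)
      (M.foldr (fun i g => (partialDeriv i)^[ν i] g) f) B := by
  induction h with
  | nil => exact eqOn_refl _ _
  | cons i _ ih => exact eqOn_iterate_partialDeriv hB ih i _
  | swap i j L =>
    exact iterate_partialDeriv_comm hB (analyticOnNhd_foldr_partialDeriv hf ν L) j i _ _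
  | trans _ _ ih₁ ih₂ => exact ih₁.trans ih₂

theorem hasDerivAt_comp_update {z : Fin n → ℂ} {i : Fin n} {t : ℂ}
    (hf : DifferentiableAt ℂ f (Function.update z i t)) :
    HasDerivAt (fun s => f (Function.update z i s)) (partialDeriv i f (Function.update z i t)) t :=
  hf.hasFDerivAt.comp_hasDerivAt t (hasDerivAt_update z i t)

theorem taylorCoeff_eq_zero_iff {ν : Fin n → ℕ} :
    taylorCoeff f ν = 0 ↔ mixedPartialDeriv ν f 0 = 0 := by
  rw [taylorCoeff, div_eq_zero_iff, or_iff_left]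
  exact_mod_cast Finset.prod_ne_zero_iff.mpr fun i _ => Nat.factorial_ne_zero _

end PartialDerivatives

section Vanishing

variable {n : ℕ} {f : (Fin n → ℂ) → ℂ} {r : ℝ}

theorem update_mem_ball {z : Fin n → ℂ} (hz : z ∈ Metric.ball (0 : Fin n → ℂ) r) (i : Fin n)
    {t : ℂ} (ht : t ∈ Metric.ball (0 : ℂ) r) :
    Function.update z i t ∈ Metric.ball (0 : Fin n → ℂ) r := by
  have hr : 0 < r := Metric.pos_of_mem_ball hz
  rw [mem_ball_zero_iff, pi_norm_lt_iff hr] at hz ⊢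
  rw [mem_ball_zero_iff] at ht
  exact (Function.forall_update_iff z fun _ w => ‖w‖ < r).mpr ⟨ht, fun l _ => hz l⟩

theorem eq_zero_of_iterate_partialDeriv_eq_zero (hf : AnalyticOnNhd ℂ f (Metric.ball 0 r))
    {z : Fin n → ℂ} (hz : z ∈ Metric.ball (0 : Fin n → ℂ) r) (i : Fin n)
    (h : ∀ a : ℕ, (partialDeriv i)^[a] f (Function.update z i 0) = 0) : f z = 0 := by
  have hr : 0 < r := Metric.pos_of_mem_ball hz
  have hzi : z i ∈ Metric.ball (0 : ℂ) r := by
    rw [mem_ball_zero_iff] at hz ⊢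
    exact (norm_le_pi_norm z i).trans_lt hz
  have hderiv (a : ℕ) {t : ℂ} (ht : t ∈ Metric.ball (0 : ℂ) r) :=
    hasDerivAt_comp_update
      (analyticOnNhd_iterate_partialDeriv hf i a _ (update_mem_ball hz i ht)).differentiableAt
  have hiter (a : ℕ) : EqOn (iteratedDeriv a fun t => f (Function.update z i t))
      (fun t => (partialDeriv i)^[a] f (Function.update z i t)) (Metric.ball 0 r) := by
    induction a with
    | zero => intro t _; simp
    | succ a ih =>
      intro t ht
      rw [iteratedDeriv_succ,
        Filter.EventuallyEq.deriv_eq (ih.eventuallyEq_of_mem (Metric.isOpen_ball.mem_nhds ht)),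
        Function.iterate_succ_apply', (hderiv a ht).deriv]
  have htaylor := Complex.taylorSeries_eq_on_ball (f := fun t => f (Function.update z i t))
    (fun t ht => (hderiv 0 ht).differentiableAt.differentiableWithinAt) hzi
  rw [Function.update_eq_self] at htaylor
  rw [← htaylor]
  refine (tsum_congr fun a => ?_).trans tsum_zero
  rw [hiter a (Metric.mem_ball_self hr)]
  simp [h a]

theorem partialDeriv_eq_zero_of_eq_zero_on_coordHyperplane {B : Set (Fin n → ℂ)} (hB : IsOpen B)
    (hf : DifferentiableOn ℂ f B) {i j : Fin n} (hij : i ≠ j) (h : ∀ z ∈ B, z i = 0 → f z = 0)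
    {z : Fin n → ℂ} (hz : z ∈ B) (hzi : z i = 0) : partialDeriv j f z = 0 := by
  have hd := hasDerivAt_comp_update (z := z) (i := j) (t := z j)
    (by simpa using hf.differentiableAt (hB.mem_nhds hz))
  rw [Function.update_eq_self] at hd
  refine hd.unique ((hasDerivAt_const _ (0 : ℂ)).congr_of_eventuallyEq ?_)
  have hmem : ∀ᶠ t in 𝓝 (z j), Function.update z j t ∈ B :=
    (hasDerivAt_update z j (z j)).continuousAt.eventually_mem
      (by simpa using hB.mem_nhds hz)
  filter_upwards [hmem] with t ht
  exact h _ ht (by rw [Function.update_of_ne hij, hzi])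

end Vanishing

section NonIsolatedZeros

variable {ρ r : ℝ}

theorem exists_eq_zero_of_norm_lt_of_le_norm_on_sphere {h : ℂ → ℂ} {c : ℝ} (hρ : 0 < ρ)
    (hh : DifferentiableOn ℂ h (Metric.closedBall 0 ρ)) (h₀ : ‖h 0‖ < c)
    (hc : ∀ t ∈ Metric.sphere (0 : ℂ) ρ, c ≤ ‖h t‖) :
    ∃ t ∈ Metric.closedBall (0 : ℂ) ρ, h t = 0 := by
  by_contra! hne
  have hcpos : 0 < c := (norm_nonneg _).trans_lt h₀
  have hinv : ‖(h 0)⁻¹‖ ≤ c⁻¹ :=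
    Complex.norm_le_of_forall_mem_frontier_norm_le (f := fun t => (h t)⁻¹) Metric.isBounded_ball
      (DifferentiableOn.diffContOnCl (by rw [closure_ball _ hρ.ne']; exact hh.inv hne))
      (fun t ht => by
        rw [frontier_ball _ hρ.ne'] at ht
        rw [norm_inv]
        exact inv_anti₀ hcpos (hc t ht))
      (subset_closure (Metric.mem_ball_self hρ))
  rw [norm_inv, inv_le_inv₀ (norm_pos_iff.mpr (hne 0 (Metric.mem_closedBall_self hρ.le))) hcpos]
    at hinv
  exact h₀.not_ge hinv

theorem eventually_exists_mem_closedBall_eq_zero {g : ℂ × ℂ → ℂ} (hρ : 0 < ρ) (hρr : ρ < r)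
    (hg : DifferentiableOn ℂ g (Metric.ball 0 r)) (h₀ : g 0 = 0)
    (hne : ∀ t ∈ Metric.sphere (0 : ℂ) ρ, g (0, t) ≠ 0) :
    ∀ᶠ s in 𝓝 (0 : ℂ), ∃ t ∈ Metric.closedBall (0 : ℂ) ρ, g (s, t) = 0 := by
  have hr : 0 < r := hρ.trans hρr
  have hdiff {s t : ℂ} (hs : s ∈ Metric.ball 0 r) (ht : t ∈ Metric.closedBall 0 ρ) :
      DifferentiableAt ℂ g (s, t) := by
    refine hg.differentiableAt (Metric.isOpen_ball.mem_nhds ?_)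
    rw [mem_ball_zero_iff] at hs ⊢
    exact max_lt hs ((mem_closedBall_zero_iff.mp ht).trans_lt hρr)
  have hslice {s : ℂ} (hs : s ∈ Metric.ball 0 r) :
      DifferentiableOn ℂ (fun t => g (s, t)) (Metric.closedBall 0 ρ) := fun t ht =>
    ((hdiff hs ht).comp t (by fun_prop)).differentiableWithinAt
  have h0r : (0 : ℂ) ∈ Metric.ball 0 r := Metric.mem_ball_self hr
  have hsub : Metric.sphere (0 : ℂ) ρ ⊆ Metric.closedBall 0 ρ := Metric.sphere_subset_closedBall
  obtain ⟨t₀, ht₀, hmin⟩ := (isCompact_sphere (0 : ℂ) ρ).exists_isMinOn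
    (NormedSpace.sphere_nonempty.mpr hρ.le) ((hslice h0r).continuousOn.mono hsub).norm
  obtain ⟨c, hc, hct₀⟩ := exists_between (norm_pos_iff.mpr (hne t₀ ht₀))
  have hsphere : ∀ᶠ s in 𝓝 (0 : ℂ), ∀ t ∈ Metric.sphere (0 : ℂ) ρ, c < ‖g (s, t)‖ :=
    (isCompact_sphere (0 : ℂ) ρ).eventually_forall_of_forall_eventually fun t ht =>
      (hdiff h0r (hsub ht)).continuousAt.norm.eventually_const_lt (hct₀.trans_le (hmin ht))
  have hcenter : ∀ᶠ s in 𝓝 (0 : ℂ), ‖g (s, 0)‖ < c := by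
    have hcont : ContinuousAt (fun s => g (s, 0)) 0 :=
      (hdiff h0r (Metric.mem_closedBall_self hρ.le)).continuousAt.comp
        (f := fun s : ℂ => (s, (0 : ℂ))) (by fun_prop)
    exact hcont.norm.eventually_lt_const (by simpa [Prod.mk_zero_zero, h₀] using hc)
  filter_upwards [hsphere, hcenter, Metric.ball_mem_nhds 0 hr] with s hss hsc hsr
  exact exists_eq_zero_of_norm_lt_of_le_norm_on_sphere hρ (hslice hsr) hsc fun t ht => (hss t ht).le

theorem exists_ne_zero_eq_zero_prod {g : ℂ × ℂ → ℂ} (hr : 0 < r)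
    (hg : DifferentiableOn ℂ g (Metric.ball 0 r)) (h₀ : g 0 = 0) :
    ∃ p ∈ Metric.ball (0 : ℂ × ℂ) r, p ≠ 0 ∧ g p = 0 := by
  by_contra! hne
  obtain ⟨ρ, hρ, hρr⟩ := exists_between hr
  have hmem {s t : ℂ} (hs : s ∈ Metric.ball 0 r) (ht : t ∈ Metric.closedBall 0 ρ) :
      (s, t) ∈ Metric.ball (0 : ℂ × ℂ) r := by
    rw [mem_ball_zero_iff] at hs ⊢
    exact max_lt hs ((mem_closedBall_zero_iff.mp ht).trans_lt hρr)
  have hzeros := eventually_exists_mem_closedBall_eq_zero hρ hρr hg h₀ fun t ht =>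
    hne _ (hmem (Metric.mem_ball_self hr) (Metric.sphere_subset_closedBall ht)) fun h =>
      ne_zero_of_mem_sphere hρ.ne' ⟨t, ht⟩ (Prod.mk_eq_zero.mp h).2
  have hpunctured : ∀ᶠ s in 𝓝[≠] (0 : ℂ), s ≠ 0 ∧ s ∈ Metric.ball 0 r ∧
      ∃ t ∈ Metric.closedBall (0 : ℂ) ρ, g (s, t) = 0 := by
    filter_upwards [self_mem_nhdsWithin, nhdsWithin_le_nhds (Metric.ball_mem_nhds 0 hr),
      nhdsWithin_le_nhds hzeros] with s hs0 hs ht using ⟨hs0, hs, ht⟩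
  obtain ⟨s, hs0, hs, t, ht, hst⟩ := hpunctured.exists
  exact hne (s, t) (hmem hs ht) (fun h => hs0 (Prod.mk_eq_zero.mp h).1) hst

theorem exists_ne_zero_eq_zero_of_ne {n : ℕ} {f : (Fin n → ℂ) → ℂ} (hr : 0 < r)
    (hf : DifferentiableOn ℂ f (Metric.ball 0 r)) (h₀ : f 0 = 0) {j k : Fin n} (hjk : j ≠ k) :
    ∃ z ∈ Metric.ball (0 : Fin n → ℂ) r, z ≠ 0 ∧ (∀ l, l ≠ j → l ≠ k → z l = 0) ∧ f z = 0 := by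
  let φ : ℂ × ℂ → Fin n → ℂ := fun p => Function.update (Function.update 0 j p.1) k p.2
  have hφj (p : ℂ × ℂ) : φ p j = p.1 := by simp [φ, Function.update_of_ne hjk]
  have hφk (p : ℂ × ℂ) : φ p k = p.2 := by simp [φ]
  have hφd : Differentiable ℂ φ := differentiable_pi.mpr fun l => by
    simp only [φ, Function.update_apply, Pi.zero_apply]
    split_ifs <;> fun_prop
  have hφ : MapsTo φ (Metric.ball 0 r) (Metric.ball 0 r) := fun p hp => by
    obtain ⟨h₁, h₂⟩ := max_lt_iff.mp (mem_ball_zero_iff.mp hp)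
    exact update_mem_ball (update_mem_ball (Metric.mem_ball_self hr) j
      (mem_ball_zero_iff.mpr h₁)) k (mem_ball_zero_iff.mpr h₂)
  have hφ0 : φ 0 = 0 := by simp [φ]
  obtain ⟨p, hp, hp0, hfp⟩ := exists_ne_zero_eq_zero_prod hr (g := f ∘ φ)
    (hf.comp hφd.differentiableOn hφ) (by rw [Function.comp_apply, hφ0, h₀])
  refine ⟨φ p, hφ hp, fun h => hp0 (Prod.ext ?_ ?_), fun l hj hk => ?_, hfp⟩
  · rw [← hφj, h]; rfl
  · rw [← hφk, h]; rfl
  · simp [φ, Function.update_of_ne hk, Function.update_of_ne hj]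

end NonIsolatedZeros

section Singularity

variable {f : (Fin 3 → ℂ) → ℂ} {i j k : Fin 3} {r : ℝ}

theorem IsFrame.taylorCoeff_eq_zero_iff (h : IsFrame i j k) (hf : AnalyticAt ℂ f 0)
    (ν : Fin 3 → ℕ) : taylorCoeff f ν = 0 ↔
      (partialDeriv i)^[ν i] ((partialDeriv j)^[ν j] ((partialDeriv k)^[ν k] f)) 0 = 0 := by
  obtain ⟨B, hB, hBo, h0⟩ := eventually_nhds_iff.mp hf.eventually_analyticAt
  have heq := eqOn_foldr_partialDeriv_of_perm hBo hB ν h.finRange_perm h0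
  rw [NewtonDiagram.taylorCoeff_eq_zero_iff, mixedPartialDeriv, heq]
  rfl

theorem IsIsolatedSingularity.exists_ball (hf : IsIsolatedSingularity f) : ∃ r : ℝ, 0 < r ∧
    AnalyticOnNhd ℂ f (Metric.ball 0 r) ∧
    ∀ z ∈ Metric.ball (0 : Fin 3 → ℂ) r, z ≠ 0 → ∃ i, partialDeriv i f z ≠ 0 := by
  obtain ⟨r, hr, h⟩ := Metric.eventually_nhds_iff_ball.mp
    (hf.analyticAt.eventually_analyticAt.and (eventually_nhdsWithin_iff.mp hf.isolated))
  exact ⟨r, hr, fun z hz => (h z hz).1, fun z hz => (h z hz).2⟩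

theorem IsSingularity.two_le_sum (hf : IsSingularity f) {ν : Fin 3 → ℕ}
    (hν : taylorCoeff f ν ≠ 0) : 2 ≤ ∑ l, ν l := by
  by_contra! hlt
  by_cases h : ∃ i, ν i ≠ 0
  · obtain ⟨i, hi⟩ := h
    obtain ⟨j, k, hfr⟩ := exists_isFrame i
    rw [hfr.sum_eq] at hlt
    obtain ⟨h₁, h₂, h₃⟩ : ν i = 1 ∧ ν j = 0 ∧ ν k = 0 := by omega
    refine hν ((hfr.taylorCoeff_eq_zero_iff hf.analyticAt ν).mpr ?_)
    rw [h₁, h₂, h₃]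
    exact hf.gradient_zero i
  · push Not at h
    obtain ⟨j, k, hfr⟩ := exists_isFrame 0
    refine hν ((hfr.taylorCoeff_eq_zero_iff hf.analyticAt ν).mpr ?_)
    rw [h, h, h]
    exact hf.map_zero

theorem IsIsolatedSingularity.exists_taylorCoeff_ne_zero_near_axis (hf : IsIsolatedSingularity f)
    (hfr : IsFrame i j k) : ∃ ν, taylorCoeff f ν ≠ 0 ∧ ν j + ν k ≤ 1 := by
  by_contra! hno
  obtain ⟨r, hr, han, hiso⟩ := hf.exists_ball
  have hcoeff (a b c : ℕ) (hbc : b + c ≤ 1) :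
      (partialDeriv i)^[a] ((partialDeriv j)^[b] ((partialDeriv k)^[c] f)) 0 = 0 := by
    obtain ⟨ν, rfl, rfl, rfl⟩ := hfr.exists_eq a b c
    exact (hfr.taylorCoeff_eq_zero_iff hf.analyticAt ν).mp
      (not_ne_iff.mp fun h => hbc.not_gt (hno ν h))
  have hgrad : ∀ l, ∀ a, (partialDeriv i)^[a] (partialDeriv l f) 0 = 0 :=
    hfr.forall_iff.mpr ⟨fun a => hcoeff (a + 1) 0 0 (by simp), fun a => hcoeff a 1 0 (by simp),
      fun a => hcoeff a 0 1 (by simp)⟩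
  obtain ⟨s, hs, hs0⟩ : ∃ s ∈ Metric.ball (0 : ℂ) r, s ≠ 0 :=
    ⟨(r / 2 : ℝ), by simpa [abs_of_pos hr] using hr, by simpa using hr.ne'⟩
  have hz := update_mem_ball (Metric.mem_ball_self hr) i hs
  obtain ⟨l, hl⟩ := hiso _ hz fun h => hs0 (by simpa using congrFun h i)
  refine hl (eq_zero_of_iterate_partialDeriv_eq_zero (analyticOnNhd_partialDeriv han l) hz i
    fun a => ?_)
  simpa using hgrad l a

theorem IsFrame.eq_zero_of_taylorCoeff_eq_zero (hfr : IsFrame i j k)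
    (han : AnalyticOnNhd ℂ f (Metric.ball 0 r)) (h : ∀ ν, ν i = 0 → taylorCoeff f ν = 0)
    {z : Fin 3 → ℂ} (hz : z ∈ Metric.ball (0 : Fin 3 → ℂ) r) (hzi : z i = 0) : f z = 0 := by
  have h0 : (0 : Fin 3 → ℂ) ∈ Metric.ball (0 : Fin 3 → ℂ) r :=
    Metric.mem_ball_self (Metric.pos_of_mem_ball hz)
  have h0' : (0 : ℂ) ∈ Metric.ball (0 : ℂ) r :=
    Metric.mem_ball_self (Metric.pos_of_mem_ball hz)
  refine eq_zero_of_iterate_partialDeriv_eq_zero han hz k fun b => ?_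
  refine eq_zero_of_iterate_partialDeriv_eq_zero (analyticOnNhd_iterate_partialDeriv han k b)
    (update_mem_ball hz k h0') j fun a => ?_
  have horigin : Function.update (Function.update z k 0) j 0 = 0 :=
    hfr.ext (by simp [hfr.ne_left, hfr.ne_outer, hzi]) (by simp) (by simp [hfr.ne_right.symm])
  obtain ⟨ν, hi, rfl, rfl⟩ := hfr.exists_eq 0 a b
  have hν := (hfr.taylorCoeff_eq_zero_iff (han 0 h0) ν).mp (h ν hi)
  rwa [hi, ← horigin] at hν

theorem IsIsolatedSingularity.exists_taylorCoeff_ne_zero_on_plane (hf : IsIsolatedSingularity f)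
    (i : Fin 3) : ∃ ν, taylorCoeff f ν ≠ 0 ∧ ν i = 0 := by
  by_contra! hno
  obtain ⟨r, hr, han, hiso⟩ := hf.exists_ball
  obtain ⟨j, k, hfr⟩ := exists_isFrame i
  have hplane (z : Fin 3 → ℂ) (hz : z ∈ Metric.ball (0 : Fin 3 → ℂ) r) (hzi : z i = 0) : f z = 0 :=
    hfr.eq_zero_of_taylorCoeff_eq_zero han (fun ν hi => not_ne_iff.mp fun h => hno ν h hi) hz hzi
  have htangent {l : Fin 3} (hl : i ≠ l) {z : Fin 3 → ℂ}
      (hz : z ∈ Metric.ball (0 : Fin 3 → ℂ) r) (hzi : z i = 0) : partialDeriv l f z = 0 :=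
    partialDeriv_eq_zero_of_eq_zero_on_coordHyperplane Metric.isOpen_ball han.differentiableOn hl
      hplane hz hzi
  obtain ⟨z, hz, hz0, hzjk, hnormal⟩ := exists_ne_zero_eq_zero_of_ne hr
    (analyticOnNhd_partialDeriv han i).differentiableOn (hf.gradient_zero i) hfr.ne_right
  have hzi : z i = 0 := hzjk i hfr.ne_left hfr.ne_outer
  obtain ⟨l, hl⟩ := hiso z hz hz0
  exact hl (hfr.forall_iff (p := fun l => partialDeriv l f z = 0) |>.mpr
    ⟨hnormal, htangent hfr.ne_left hz hzi, htangent hfr.ne_outer hz hzi⟩ l)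

theorem IsIsolatedSingularity.isolatedSupport (hf : IsIsolatedSingularity f) :
    IsolatedSupport {ν | taylorCoeff f ν ≠ 0} where
  order _ hν := hf.toIsSingularity.two_le_sum hν
  near_axis _ _ _ := hf.exists_taylorCoeff_ne_zero_near_axis
  meets_plane := hf.exists_taylorCoeff_ne_zero_on_plane

theorem mem_newtonFaces_two_iff {S : Set (EuclideanSpace ℝ (Fin 3))} :
    S ∈ newtonFaces f 2 ↔
      ∃ u, IsFacet {ν | taylorCoeff f ν ≠ 0} u ∧ S = face {ν | taylorCoeff f ν ≠ 0} u := by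
  have hpoly : newtonDiagram f = polyhedron {ν | taylorCoeff f ν ≠ 0} := rfl
  rw [newtonFaces, newtonBoundary, hpoly]
  constructor
  · rintro ⟨⟨⟨u, hu, -, rfl⟩, hc⟩, hdim⟩
    have hne : (supportSet u (polyhedron {ν | taylorCoeff f ν ≠ 0})).Nonempty := by
      by_contra h
      rw [not_nonempty_iff_eq_empty.mp h, dim, vectorSpan_empty, finrank_bot] at hdim
      exact two_ne_zero hdim.symm
    have hpos := pos_of_isCompact_supportSet hu hne hc
    rw [supportSet_polyhedron hpos] at hdim ⊢
    exact ⟨u, (dim_face_eq_two_iff hpos).mp hdim, rfl⟩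
  · rintro ⟨u, hu, rfl⟩
    refine ⟨⟨⟨WithLp.toLp 2 u, fun l => (hu.pos l).le, fun h => ?_, ?_⟩, isCompact_face hu.pos⟩,
      (dim_face_eq_two_iff hu.pos).mpr hu⟩
    · exact (hu.pos 0).ne' (congrArg (fun x : EuclideanSpace ℝ (Fin 3) => x 0) h)
    · exact (supportSet_polyhedron (u := WithLp.toLp 2 u) hu.pos).symm

end Singularity

end NewtonDiagram

end

theorem lemma3 (f : (Fin 3 → ℂ) → ℂ) (hf : NewtonDiagram.IsIsolatedSingularity f)
    (hne : (NewtonDiagram.newtonFaces f 2 \ NewtonDiagram.exceptionalFaces f).Nonempty) :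
    ∀ i : Fin 3, ∃ S ∈ NewtonDiagram.newtonFaces f 2 \ NewtonDiagram.exceptionalFaces f,
      (∃ W ∈ NewtonDiagram.axis i, W ∈ NewtonDiagram.vertices S) ∨
      (∃ j k : Fin 3, j ≠ i ∧ k ≠ i ∧ j ≠ k ∧
        ∃ W ∈ NewtonDiagram.vertices S, ∃ Y ∈ NewtonDiagram.vertices S,
          W ∈ NewtonDiagram.coordPlane i j ∧
          Metric.infDist W (NewtonDiagram.axis i) = 1 ∧
          Y ∈ NewtonDiagram.coordPlane i k ∧
          NewtonDiagram.IsEdge S W Y) := by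
  open NewtonDiagram in
  intro i
  obtain ⟨S₀, hS₀, hS₀_unexc⟩ := hne
  obtain ⟨v, hv, rfl⟩ := mem_newtonFaces_two_iff.mp hS₀
  have hv_unexc : ¬ IsExceptionalWeight {ν | taylorCoeff f ν ≠ 0} v := fun h =>
    hS₀_unexc ⟨hS₀, exists_isExceptionalWrt_of_isExceptionalWeight hv h⟩
  obtain ⟨u, hu, hu_unexc, htouch⟩ := hf.isolatedSupport.exists_touchesAxis hv hv_unexc i
  have hu_face := mem_newtonFaces_two_iff.mpr ⟨u, hu, rfl⟩
  exact ⟨face _ u, ⟨hu_face, fun ⟨_, _, hl⟩ =>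
    hu_unexc (isExceptionalWeight_of_isExceptionalWrt hu hl)⟩,
    htouch.exists_vertex_or_exists_isEdge hu.pos⟩
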